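/- Let $I\subset(0,\infty)$ be a nonempty open interval, let $B:I\to(0,\infty)$ be of class $C^4$, and consider the static spherically symmetric metric $$ds^2=-B(r)\,dt^2+\frac{dr^2}{B(r)}+r^2(d\theta^2+\sin^2\theta\,d\phi^2),\qquad r\in I .$$ Let $R_{jklm}$ be its Riemann tensor, with $(\nabla_j\nabla_k-\nabla_k\nabla_j)u_l=R_{jklm}u^m$, $R_{km}=g^{jl}R_{jklm}$ the Ricci tensor, $R=g^{km}R_{km}$, $C_{jklm}$ the Weyl tensor, $C_{jkl}=\nabla_jR_{kl}-\nabla_kR_{jl}-\frac16(g_{kl}\nabla_jR-g_{jl}\nabla_kR)$ the Cotton tensor and $\mathscr B_{kl}=2\nabla^j\nabla^mC_{jklm}+R^{jm}C_{jklm}$ the Bach tensor. Put $$A(r)=\frac{1-B}{r^2}+\frac{B''}{2},\qquad E(r)=\frac12\Big[\frac{1-B}{r^2}+\frac{B'}{r}-\frac{B''}{2}\Big],$$ and let $u=-\sqrt B\,dt$, $n=dr/\sqrt B$. All identities for $B$ are on the whole of $I$, and $b_i,\kappa,\beta$ denote real constants. a) $R=0$ if and only if $2\frac{1-B}{r^2}-4\frac{B'}{r}-B''=0$,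 if and only if $B(r)=\frac{b_{-2}}{r^2}+\frac{b_{-1}}{r}+1$ for some constants. In that case $A(r)=2b_{-2}/r^4$ and $R_{jk}=A(r)\,[u_ju_k+\frac12g_{jk}-n_jn_k]$, which is traceless. b) The metric is conformally flat ($C_{jklm}=0$) if and only if $E(r)=0$, if and only if $B(r)=1+b_1r+b_2r^2$ for some constants. c) The metric is harmonic ($\nabla^mC_{jklm}=0$) if and only if $B(r)=\frac{b_{-1}}{r}+1+b_1r+b_2r^2$ for some constants. d) The metric is bi-harmonic ($\nabla^jC_{jkl}=0$) if and only if $B$ is of the form in c) or $B(r)=\kappa r^2$ for some constant $\kappa$. If $B(r)=\kappa r^2$, the metric is not harmonic, and $A(r)=1/r^2$, $E(r)=1/(2r^2)$. e) The metric is Einstein ($R_{jk}=c\,g_{jk}$ with $c$ constant) if and only if $A(r)=0$, if and only if $B(r)=\frac{b_{-1}}{r}+1+b_2r^2$ for some constants. f) The metric has constant curvature ($R_{jklm}=K(g_{jl}g_{km}-g_{jm}g_{kl})$ with $K$ constant) if and only if $A(r)=0$ and $C_{jklm}=0$, if and only if $B(r)=1+b_2r^2$ for some constant. In that case $R_{jklm}=\frac{R}{12}(g_{jl}g_{km}-g_{jm}g_{kl})$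 with $R=-12b_2$. g) The metric has zero Bach tensor ($\mathscr B_{kl}=0$) if and only if $B(r)=\frac{b_{-1}}{r}+b_0+b_1r+b_2r^2$ for some constants with $1-b_0^2=-3b_1b_{-1}$. Equivalently, either $B$ has the Mannheim–Kazanas form $$B(r)=-\frac{\beta(2-3b_1\beta)}{r}+(1-3b_1\beta)+b_1r+b_2r^2$$ for some constants $\beta,b_1,b_2$, or $B$ belongs to the remaining family $b_1=0$, $b_0=-1$, that is $B(r)=\frac{b_{-1}}{r}-1+b_2r^2$ for some constants. -/

import Mathlib

open scoped Matrix

noncomputable section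

namespace StaticSpherical

/-! Tensor calculus in a coordinate chart of a four-dimensional pseudo-Riemannian manifold.
Points of the chart are coordinate vectors `x : Fin 4 → ℝ`; tensor fields are given by their
covariant components. -/

/-- Coordinate vectors. -/
abbrev Pt : Type := Fin 4 → ℝ

/-- A metric tensor in coordinates: `g x i j = g_{ij}(x)`. -/
abbrev Metric : Type := Pt → Matrix (Fin 4) (Fin 4) ℝ

/-- Partial derivative `∂_i f` at `x`. -/
def pd (i : Fin 4) (f : Pt → ℝ) (x : Pt) : ℝ :=
  deriv (fun s => f (Function.update x i s)) (x i)

/-- The inverse metric `g^{ij}`. -/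
def ginv (g : Metric) (x : Pt) (i j : Fin 4) : ℝ := (g x)⁻¹ i j

/-- Christoffel symbols `Γ^k_{ij}` of the Levi-Civita connection. -/
def christoffel (g : Metric) (x : Pt) (k i j : Fin 4) : ℝ :=
  (1 / 2) * ∑ l, ginv g x k l *
    (pd i (fun y => g y j l) x + pd j (fun y => g y i l) x - pd l (fun y => g y i j) x)

/-- The curvature `R^l_{mjk}` with
`R^l_{mjk} = ∂_j Γ^l_{km} - ∂_k Γ^l_{jm} + Γ^l_{jp} Γ^p_{km} - Γ^l_{kp} Γ^p_{jm}`. -/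
def riemannUp (g : Metric) (x : Pt) (l m j k : Fin 4) : ℝ :=
  pd j (fun y => christoffel g y l k m) x - pd k (fun y => christoffel g y l j m) x
    + ∑ p, (christoffel g x l j p * christoffel g x p k m
      - christoffel g x l k p * christoffel g x p j m)

/-- The covariant Riemann tensor `R_{jklm}`, with the index order and sign fixed by
`(∇_j ∇_k - ∇_k ∇_j) u_l = R_{jklm} u^m`. -/
def riemann (g : Metric) (x : Pt) (j k l m : Fin 4) : ℝ :=
  ∑ p, g x l p * riemannUp g x p m j k

/-- The Ricci tensor `R_{km} = g^{jl} R_{jklm}`. -/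
def ricci (g : Metric) (x : Pt) (k m : Fin 4) : ℝ :=
  ∑ j, ∑ l, ginv g x j l * riemann g x j k l m

/-- The scalar curvature `R = g^{km} R_{km}`. -/
def scalarCurv (g : Metric) (x : Pt) : ℝ :=
  ∑ k, ∑ m, ginv g x k m * ricci g x k m

/-- The Weyl tensor `C_{jklm}` in dimension four. -/
def weyl (g : Metric) (x : Pt) (j k l m : Fin 4) : ℝ :=
  riemann g x j k l m
    + (1 / 2) * (g x j m * ricci g x k l - g x k m * ricci g x j l
      + g x k l * ricci g x j m - g x j l * ricci g x k m)
    - scalarCurv g x / 6 * (g x j m * g x k l - g x k m * g x j l)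

/-- Covariant derivative `∇_i T_{ab}` of a covariant 2-tensor. -/
def covD2 (g : Metric) (T : Pt → Fin 4 → Fin 4 → ℝ) (x : Pt) (i a b : Fin 4) : ℝ :=
  pd i (fun y => T y a b) x
    - ∑ p, (christoffel g x p i a * T x p b + christoffel g x p i b * T x a p)

/-- Covariant derivative `∇_i T_{abc}` of a covariant 3-tensor. -/
def covD3 (g : Metric) (T : Pt → Fin 4 → Fin 4 → Fin 4 → ℝ) (x : Pt) (i a b c : Fin 4) : ℝ :=
  pd i (fun y => T y a b c) x
    - ∑ p, (christoffel g x p i a * T x p b c + christoffel g x p i b * T x a p c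
      + christoffel g x p i c * T x a b p)

/-- Covariant derivative `∇_i T_{abcd}` of a covariant 4-tensor. -/
def covD4 (g : Metric) (T : Pt → Fin 4 → Fin 4 → Fin 4 → Fin 4 → ℝ) (x : Pt)
    (i a b c d : Fin 4) : ℝ :=
  pd i (fun y => T y a b c d) x
    - ∑ p, (christoffel g x p i a * T x p b c d + christoffel g x p i b * T x a p c d
      + christoffel g x p i c * T x a b p d + christoffel g x p i d * T x a b c p)

/-- The Cotton tensor `C_{jkl} = ∇_j R_{kl} - ∇_k R_{jl} - (g_{kl} ∂_j R - g_{jl} ∂_k R) / 6`. -/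
def cotton (g : Metric) (x : Pt) (j k l : Fin 4) : ℝ :=
  covD2 g (ricci g) x j k l - covD2 g (ricci g) x k j l
    - (1 / 6) * (g x k l * pd j (scalarCurv g) x - g x j l * pd k (scalarCurv g) x)

/-- The divergence `∇^m C_{jklm}` of the Weyl tensor. -/
def divWeyl (g : Metric) (x : Pt) (j k l : Fin 4) : ℝ :=
  ∑ i, ∑ m, ginv g x i m * covD4 g (weyl g) x i j k l m

/-- The divergence `∇^j C_{jkl}` of the Cotton tensor. -/
def divCotton (g : Metric) (x : Pt) (k l : Fin 4) : ℝ :=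
  ∑ i, ∑ j, ginv g x i j * covD3 g (cotton g) x i j k l

/-- The Bach tensor `2 ∇^j ∇^m C_{jklm} + R^{jm} C_{jklm}`. -/
def bach (g : Metric) (x : Pt) (k l : Fin 4) : ℝ :=
  2 * (∑ i, ∑ j, ginv g x i j * covD3 g (divWeyl g) x i j k l)
    + ∑ j, ∑ m, (∑ a, ∑ b, ginv g x j a * ginv g x m b * ricci g x a b) * weyl g x j k l m

/-! Geometric conditions on a region `D` of the chart. -/

/-- Zero scalar curvature. -/
def ScalarFlatOn (g : Metric) (D : Set Pt) : Prop := ∀ x ∈ D, scalarCurv g x = 0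

/-- Conformally flat: the Weyl tensor vanishes. -/
def ConformallyFlatOn (g : Metric) (D : Set Pt) : Prop := ∀ x ∈ D, ∀ j k l m, weyl g x j k l m = 0

/-- Harmonic (Weyl tensor): `∇^m C_{jklm} = 0`. -/
def HarmonicOn (g : Metric) (D : Set Pt) : Prop := ∀ x ∈ D, ∀ j k l, divWeyl g x j k l = 0

/-- Bi-harmonic: `∇^j C_{jkl} = 0` for the Cotton tensor `C_{jkl}`. -/
def BiharmonicOn (g : Metric) (D : Set Pt) : Prop := ∀ x ∈ D, ∀ k l, divCotton g x k l = 0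

/-- Einstein: the Ricci tensor is a constant multiple of the metric. -/
def EinsteinOn (g : Metric) (D : Set Pt) : Prop :=
  ∃ c : ℝ, ∀ x ∈ D, ∀ j k, ricci g x j k = c * g x j k

/-- Constant (sectional) curvature. -/
def ConstantCurvatureOn (g : Metric) (D : Set Pt) : Prop :=
  ∃ K : ℝ, ∀ x ∈ D, ∀ j k l m,
    riemann g x j k l m = K * (g x j l * g x k m - g x j m * g x k l)

/-- Zero Bach tensor. -/
def BachFlatOn (g : Metric) (D : Set Pt) : Prop := ∀ x ∈ D, ∀ k l, bach g x k l = 0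

/-! The static spherically symmetric metrics, in coordinates `(t, r, θ, φ) = (x 0, x 1, x 2, x 3)`. -/

/-- `ds² = - B(r) dt² + dr² / B(r) + r² (dθ² + sin² θ dφ²)`. -/
def sphMetric (B : ℝ → ℝ) : Metric := fun x =>
  Matrix.diagonal ![-B (x 1), 1 / B (x 1), x 1 ^ 2, x 1 ^ 2 * Real.sin (x 2) ^ 2]

/-- The coordinate domain `t, φ ∈ ℝ`, `r ∈ I`, `0 < θ < π`. -/
def sphDomain (I : Set ℝ) : Set Pt := {x | x 1 ∈ I ∧ x 2 ∈ Set.Ioo 0 Real.pi}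

/-- The velocity covector `u = (-√B, 0, 0, 0)`. -/
def velocity (B : ℝ → ℝ) (x : Pt) : Fin 4 → ℝ := ![-Real.sqrt (B (x 1)), 0, 0, 0]

/-- The unit radial covector `n = (0, 1/√B, 0, 0)`. The acceleration covector is
`a = (0, B'/(2B), 0, 0)` with `η = a^k a_k = B'² / (4B)`, so that `n_j n_k = a_j a_k / η`
wherever `B' ≠ 0`. -/
def radial (B : ℝ → ℝ) (x : Pt) : Fin 4 → ℝ := ![0, 1 / Real.sqrt (B (x 1)), 0, 0]

/-- `A(r) = (1 - B) / r² + B'' / 2`. -/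
def funA (B : ℝ → ℝ) (r : ℝ) : ℝ := (1 - B r) / r ^ 2 + deriv (deriv B) r / 2

/-- `E(r) = ((1 - B) / r² + B' / r - B'' / 2) / 2`. -/
def funE (B : ℝ → ℝ) (r : ℝ) : ℝ :=
  (1 / 2) * ((1 - B r) / r ^ 2 + deriv B r / r - deriv (deriv B) r / 2)

end StaticSpherical

end

/-! Every tensor involved is diagonal in the coordinate frame, or nearly so, and each component is a
function of r times a function of θ. Partial derivatives therefore reduce to one-variable
derivatives (`pd_separated`), and the whole curvature calculus collapses to a few radial scalars.
Riemann acts on coordinate planes by sectional curvatures (`riemann_eq`). Ricci has a double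
eigenvalue on (t, r) and another on (θ, φ) (`ricci_eq`), whose difference is A. Weyl is a fixed
traceless pattern times a scalar w = 2E/3 (`weyl_eq`), and Cotton is a fixed pattern times a scalar
q (`cotton_eq`). The divergence of Cotton and the Bach tensor are again diagonal (`divCotton_eq`,
`bach_eq`).

Each geometric condition thus becomes an ODE for B on I. The identities behind their integration are
r²R = -(r²(B - 1))'', w = -(r/6)((B - 1)/r)'', and (r³w)' = -r³q. Einstein means A = 0, which
integrates through (r(B - 1))'/r². The remaining two conditions share one reduction: in the
difference of the t and r eigenvalues everything cancels except a multiple of B·(rB)'''', so B > 0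
makes rB a cubic polynomial (`exists_cubic_form`).

Substituting B = m/r + b₀ + b₁r + b₂r² back leaves algebra. The bi-harmonic condition becomes (b₀ -
1)(2B/r - B') = 0 in the r eigenvalue, which splits into the harmonic family and B = κr². The Bach
tensor becomes (1 - b₀² + 3b₁m)/(3r⁴) times the diagonal pattern (1, 1, -1, -1), which gives the
quadratic constraint.

The computations use named functions for the derivatives of B, related to it only on I; they are
specialised to iterated `deriv` at the end. -/

noncomputable section

namespace StaticSpherical

/-! ### Separated fields and the metric -/

/-- A positive profile `B` on an open set `I` of positive radii, with derivatives `B1, …, B4`. -/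
structure Profile (I : Set ℝ) (B B1 B2 B3 B4 : ℝ → ℝ) : Prop where
  isOpen : IsOpen I
  pos : ∀ r ∈ I, 0 < r
  val_pos : ∀ r ∈ I, 0 < B r
  d0 : ∀ r ∈ I, HasDerivAt B (B1 r) r
  d1 : ∀ r ∈ I, HasDerivAt B1 (B2 r) r
  d2 : ∀ r ∈ I, HasDerivAt B2 (B3 r) r
  d3 : ∀ r ∈ I, HasDerivAt B3 (B4 r) r

theorem isOpen_sphDomain {I : Set ℝ} (hI : IsOpen I) : IsOpen (sphDomain I) :=
  (hI.preimage (continuous_apply 1)).inter (isOpen_Ioo.preimage (continuous_apply 2))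

theorem sin_pos_of_mem {I : Set ℝ} {x : Pt} (hx : x ∈ sphDomain I) : 0 < Real.sin (x 2) :=
  Real.sin_pos_of_mem_Ioo hx.2

/-- Partial derivatives of a field that separates as `F(r) G(θ)` on the chart domain. -/
theorem pd_separated {I : Set ℝ} (hI : IsOpen I) {x : Pt} (hx : x ∈ sphDomain I)
    {f : Pt → ℝ} {F G : ℝ → ℝ} {F' G' : ℝ} (hf : ∀ y ∈ sphDomain I, f y = F (y 1) * G (y 2))
    (hF : HasDerivAt F F' (x 1)) (hG : HasDerivAt G G' (x 2)) (i : Fin 4) :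
    pd i f x = ![0, F' * G (x 2), F (x 1) * G', 0] i := by
  have key : pd i f x = deriv (fun s => F (Function.update x i s 1) * G (Function.update x i s 2))
      (x i) := by
    -- The product formula holds only on the chart domain; openness makes it hold along the whole
    -- coordinate line near the point.
    apply Filter.EventuallyEq.deriv_eq
    have hc : ContinuousAt (fun s => Function.update x i s) (x i) := by fun_prop
    have : sphDomain I ∈ nhds (Function.update x i (x i)) := by
      rw [Function.update_eq_self]; exact (isOpen_sphDomain hI).mem_nhds hx
    filter_upwards [hc this] with s hs
    exact hf _ hs
  rw [key]
  fin_cases i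
  · simp
  · simpa using (hF.mul_const (G (x 2))).deriv
  · simpa using (hG.const_mul (F (x 1))).deriv
  · simp

/-- Radial factors of the metric coefficients. -/
def radialCoeff (B : ℝ → ℝ) (j : Fin 4) (r : ℝ) : ℝ := ![-B r, 1 / B r, r ^ 2, r ^ 2] j

/-- Derivatives of the radial factors. -/
def radialCoeff' (B B1 : ℝ → ℝ) (j : Fin 4) (r : ℝ) : ℝ :=
  ![-B1 r, -B1 r / B r ^ 2, 2 * r, 2 * r] j

/-- Angular factors of the metric coefficients. -/
def angCoeff (j : Fin 4) (θ : ℝ) : ℝ := ![1, 1, 1, Real.sin θ ^ 2] j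

/-- Derivatives of the angular factors. -/
def angCoeff' (j : Fin 4) (θ : ℝ) : ℝ := ![0, 0, 0, 2 * Real.sin θ * Real.cos θ] j

theorem sphMetric_eq (B : ℝ → ℝ) (x : Pt) (j k : Fin 4) :
    sphMetric B x j k = if j = k then radialCoeff B j (x 1) * angCoeff j (x 2) else 0 := by
  rw [sphMetric, Matrix.diagonal_apply]
  split_ifs
  · fin_cases j <;> simp [radialCoeff, angCoeff]
  · rfl

theorem hasDerivAt_angCoeff (j : Fin 4) (θ : ℝ) : HasDerivAt (angCoeff j) (angCoeff' j θ) θ := by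
  unfold angCoeff angCoeff'
  fin_cases j
  · simpa using hasDerivAt_const θ (1 : ℝ)
  · simpa using hasDerivAt_const θ (1 : ℝ)
  · simpa using hasDerivAt_const θ (1 : ℝ)
  · simpa using (Real.hasDerivAt_sin θ).fun_pow 2

variable {I : Set ℝ} {B B1 B2 B3 B4 : ℝ → ℝ}

namespace Profile

theorem hasDerivAt_radialCoeff (h : Profile I B B1 B2 B3 B4) {r : ℝ} (hr : r ∈ I) (j : Fin 4) :
    HasDerivAt (radialCoeff B j) (radialCoeff' B B1 j r) r := by
  have hB := (h.val_pos r hr).ne'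
  unfold radialCoeff radialCoeff'
  fin_cases j
  · simpa using (h.d0 r hr).fun_neg
  · simpa using (h.d0 r hr).fun_inv hB
  · simpa using hasDerivAt_pow 2 r
  · simpa using hasDerivAt_pow 2 r

theorem radialCoeff_ne_zero (h : Profile I B B1 B2 B3 B4) {r : ℝ} (hr : r ∈ I) (j : Fin 4) :
    radialCoeff B j r ≠ 0 := by
  have hB := (h.val_pos r hr).ne'
  have h0 := (h.pos r hr).ne'
  fin_cases j <;> simp [radialCoeff, hB, h0]

theorem coeff_ne_zero (h : Profile I B B1 B2 B3 B4) {x : Pt} (hx : x ∈ sphDomain I) (j : Fin 4) :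
    radialCoeff B j (x 1) * angCoeff j (x 2) ≠ 0 := by
  have hS := (sin_pos_of_mem hx).ne'
  refine mul_ne_zero (h.radialCoeff_ne_zero hx.1 j) ?_
  fin_cases j <;> simp [angCoeff, hS]

theorem ginv_eq (h : Profile I B B1 B2 B3 B4) {x : Pt} (hx : x ∈ sphDomain I) (j k : Fin 4) :
    ginv (sphMetric B) x j k =
      if j = k then (radialCoeff B j (x 1) * angCoeff j (x 2))⁻¹ else 0 := by
  have : (sphMetric B x)⁻¹
      = Matrix.diagonal (fun j => (radialCoeff B j (x 1) * angCoeff j (x 2))⁻¹) := by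
    apply Matrix.inv_eq_right_inv
    have hm : sphMetric B x
        = Matrix.diagonal (fun j => radialCoeff B j (x 1) * angCoeff j (x 2)) := by
      ext j k; rw [sphMetric_eq, Matrix.diagonal_apply]
    rw [hm, Matrix.diagonal_mul_diagonal, ← Matrix.diagonal_one]
    congr 1; funext j
    exact mul_inv_cancel₀ (h.coeff_ne_zero hx j)
  rw [ginv, this, Matrix.diagonal_apply]

theorem pd_metric (h : Profile I B B1 B2 B3 B4) {x : Pt} (hx : x ∈ sphDomain I) (i j k : Fin 4) :
    pd i (fun y => sphMetric B y j k) x = if j = k then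
      ![0, radialCoeff' B B1 j (x 1) * angCoeff j (x 2),
        radialCoeff B j (x 1) * angCoeff' j (x 2), 0] i else 0 := by
  by_cases hjk : j = k
  · rw [if_pos hjk]
    exact pd_separated h.isOpen hx (fun y _ => by rw [sphMetric_eq, if_pos hjk])
      (h.hasDerivAt_radialCoeff hx.1 j) (hasDerivAt_angCoeff j _) i
  · simp [pd, sphMetric_eq, hjk]

end Profile

/-! ### Christoffel symbols -/

/-- Radial factors of the Christoffel symbols. -/
def chrRad (B B1 : ℝ → ℝ) (k i j : Fin 4) (r : ℝ) : ℝ :=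
  (![!![0, B1 r / (2 * B r), 0, 0; B1 r / (2 * B r), 0, 0, 0; 0, 0, 0, 0; 0, 0, 0, 0],
    !![B r * B1 r / 2, 0, 0, 0; 0, -(B1 r / (2 * B r)), 0, 0; 0, 0, -(r * B r), 0;
      0, 0, 0, -(r * B r)],
    !![0, 0, 0, 0; 0, 0, 1 / r, 0; 0, 1 / r, 0, 0; 0, 0, 0, -1],
    !![0, 0, 0, 0; 0, 0, 0, 1 / r; 0, 0, 0, 1; 0, 1 / r, 1, 0]] :
    Fin 4 → Matrix (Fin 4) (Fin 4) ℝ) k i j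

/-- Derivatives of the radial factors of the Christoffel symbols. -/
def chrRad' (B B1 B2 : ℝ → ℝ) (k i j : Fin 4) (r : ℝ) : ℝ :=
  (![!![0, B2 r / (2 * B r) - B1 r ^ 2 / (2 * B r ^ 2), 0, 0;
      B2 r / (2 * B r) - B1 r ^ 2 / (2 * B r ^ 2), 0, 0, 0; 0, 0, 0, 0; 0, 0, 0, 0],
    !![(B1 r ^ 2 + B r * B2 r) / 2, 0, 0, 0;
      0, -(B2 r / (2 * B r) - B1 r ^ 2 / (2 * B r ^ 2)), 0, 0; 0, 0, -(B r + r * B1 r), 0;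
      0, 0, 0, -(B r + r * B1 r)],
    !![0, 0, 0, 0; 0, 0, -1 / r ^ 2, 0; 0, -1 / r ^ 2, 0, 0; 0, 0, 0, 0],
    !![0, 0, 0, 0; 0, 0, 0, -1 / r ^ 2; 0, 0, 0, 0; 0, -1 / r ^ 2, 0, 0]] :
    Fin 4 → Matrix (Fin 4) (Fin 4) ℝ) k i j

/-- Angular factors of the Christoffel symbols. -/
def chrAng (k i j : Fin 4) (θ : ℝ) : ℝ :=
  (![!![1, 1, 1, 1; 1, 1, 1, 1; 1, 1, 1, 1; 1, 1, 1, 1],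
    !![1, 1, 1, 1; 1, 1, 1, 1; 1, 1, 1, 1; 1, 1, 1, Real.sin θ ^ 2],
    !![1, 1, 1, 1; 1, 1, 1, 1; 1, 1, 1, 1; 1, 1, 1, Real.sin θ * Real.cos θ],
    !![1, 1, 1, 1; 1, 1, 1, 1; 1, 1, 1, Real.cos θ / Real.sin θ;
      1, 1, Real.cos θ / Real.sin θ, 1]] :
    Fin 4 → Matrix (Fin 4) (Fin 4) ℝ) k i j

/-- Derivatives of the angular factors of the Christoffel symbols. -/
def chrAng' (k i j : Fin 4) (θ : ℝ) : ℝ :=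
  (![0, !![0, 0, 0, 0; 0, 0, 0, 0; 0, 0, 0, 0; 0, 0, 0, 2 * Real.sin θ * Real.cos θ],
    !![0, 0, 0, 0; 0, 0, 0, 0; 0, 0, 0, 0; 0, 0, 0, Real.cos θ ^ 2 - Real.sin θ ^ 2],
    !![0, 0, 0, 0; 0, 0, 0, 0; 0, 0, 0, -1 - Real.cos θ ^ 2 / Real.sin θ ^ 2;
      0, 0, -1 - Real.cos θ ^ 2 / Real.sin θ ^ 2, 0]] :
    Fin 4 → Matrix (Fin 4) (Fin 4) ℝ) k i j

theorem hasDerivAt_chrAng {θ : ℝ} (hS : Real.sin θ ≠ 0) (k i j : Fin 4) :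
    HasDerivAt (chrAng k i j) (chrAng' k i j θ) θ := by
  have hsq : HasDerivAt (fun t => Real.sin t ^ 2) (2 * Real.sin θ * Real.cos θ) θ := by
    simpa using (Real.hasDerivAt_sin θ).fun_pow 2
  have hsc : HasDerivAt (fun t => Real.sin t * Real.cos t) (Real.cos θ ^ 2 - Real.sin θ ^ 2) θ := by
    exact HasDerivAt.congr_deriv ((Real.hasDerivAt_sin θ).fun_mul (Real.hasDerivAt_cos θ)) (by ring)
  have hct : HasDerivAt (fun t => Real.cos t / Real.sin t)
      (-1 - Real.cos θ ^ 2 / Real.sin θ ^ 2) θ := by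
    exact HasDerivAt.congr_deriv ((Real.hasDerivAt_cos θ).fun_div (Real.hasDerivAt_sin θ) hS) (by field_simp)
  have hc : HasDerivAt (fun _ : ℝ => (1 : ℝ)) 0 θ := hasDerivAt_const θ 1
  unfold chrAng chrAng'
  fin_cases k <;> fin_cases i <;> fin_cases j <;>
    first | exact hc | exact hsq | exact hsc | exact hct

namespace Profile

theorem hasDerivAt_chrRad (h : Profile I B B1 B2 B3 B4) {r : ℝ} (hr : r ∈ I) (k i j : Fin 4) :
    HasDerivAt (chrRad B B1 k i j) (chrRad' B B1 B2 k i j r) r := by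
  have hB := (h.val_pos r hr).ne'
  have h0 := (h.pos r hr).ne'
  have hq : HasDerivAt (fun s => B1 s / (2 * B s))
      (B2 r / (2 * B r) - B1 r ^ 2 / (2 * B r ^ 2)) r := by
    exact HasDerivAt.congr_deriv ((h.d1 r hr).fun_div ((h.d0 r hr).const_mul 2) (by simpa using hB)) (by field_simp)
  have hn := hq.fun_neg
  have hp : HasDerivAt (fun s => B s * B1 s / 2) ((B1 r ^ 2 + B r * B2 r) / 2) r := by
    exact HasDerivAt.congr_deriv (((h.d0 r hr).fun_mul (h.d1 r hr)).div_const 2) (by ring)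
  have hl : HasDerivAt (fun s => -(s * B s)) (-(B r + r * B1 r)) r := by
    exact HasDerivAt.congr_deriv (((hasDerivAt_id' r).fun_mul (h.d0 r hr)).fun_neg) (by simp)
  have hi : HasDerivAt (fun s : ℝ => 1 / s) (-1 / r ^ 2) r := by
    simpa using (hasDerivAt_id' r).fun_inv h0
  have hc : HasDerivAt (fun _ : ℝ => (0 : ℝ)) 0 r := hasDerivAt_const r 0
  have hc1 : HasDerivAt (fun _ : ℝ => (1 : ℝ)) 0 r := hasDerivAt_const r 1
  have hc2 : HasDerivAt (fun _ : ℝ => (-1 : ℝ)) 0 r := hasDerivAt_const r (-1)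
  unfold chrRad chrRad'
  fin_cases k <;> fin_cases i <;> fin_cases j <;>
    first | exact hc | exact hq | exact hn | exact hp | exact hl | exact hi | exact hc1 | exact hc2

theorem christoffel_eq (h : Profile I B B1 B2 B3 B4) {x : Pt} (hx : x ∈ sphDomain I)
    (k i j : Fin 4) : christoffel (sphMetric B) x k i j
      = chrRad B B1 k i j (x 1) * chrAng k i j (x 2) := by
  have hB := (h.val_pos _ hx.1).ne'
  have h0 := (h.pos _ hx.1).ne'
  have hS := (sin_pos_of_mem hx).ne'
  simp only [christoffel, h.ginv_eq hx, h.pd_metric hx, ite_mul, zero_mul, Finset.sum_ite_eq,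
    Finset.mem_univ, if_true]
  fin_cases k <;> fin_cases i <;> fin_cases j <;>
    simp [radialCoeff, radialCoeff', angCoeff, angCoeff', chrRad, chrAng] <;> field_simp

theorem pd_christoffel (h : Profile I B B1 B2 B3 B4) {x : Pt} (hx : x ∈ sphDomain I)
    (i k l m : Fin 4) : pd i (fun y => christoffel (sphMetric B) y k l m) x
      = ![0, chrRad' B B1 B2 k l m (x 1) * chrAng k l m (x 2),
          chrRad B B1 k l m (x 1) * chrAng' k l m (x 2), 0] i :=
  pd_separated h.isOpen hx (fun _ hy => h.christoffel_eq hy k l m)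
    (h.hasDerivAt_chrRad hx.1 k l m) (hasDerivAt_chrAng (sin_pos_of_mem hx).ne' k l m) i

end Profile

/-! ### Riemann, Ricci and Weyl tensors -/

/-- Sectional curvatures of the coordinate planes. -/
def sec (B B1 B2 : ℝ → ℝ) (j k : Fin 4) (r : ℝ) : ℝ :=
  !![0, -B2 r / 2, -B1 r / (2 * r), -B1 r / (2 * r);
    -B2 r / 2, 0, -B1 r / (2 * r), -B1 r / (2 * r);
    -B1 r / (2 * r), -B1 r / (2 * r), 0, (1 - B r) / r ^ 2;
    -B1 r / (2 * r), -B1 r / (2 * r), (1 - B r) / r ^ 2, 0] j k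

/-- Ricci eigenvalue of the `t` and `r` directions. -/
def ricT (B1 B2 : ℝ → ℝ) (r : ℝ) : ℝ := -B2 r / 2 - B1 r / r

/-- Ricci eigenvalue of the angular directions. -/
def ricA (B B1 : ℝ → ℝ) (r : ℝ) : ℝ := (1 - B r) / r ^ 2 - B1 r / r

/-- Ricci eigenvalues. -/
def ricEig (B B1 B2 : ℝ → ℝ) (k : Fin 4) (r : ℝ) : ℝ :=
  ![ricT B1 B2 r, ricT B1 B2 r, ricA B B1 r, ricA B B1 r] k

/-- The Weyl scalar, the Weyl sectional curvature of the `(t, r)` plane. -/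
def weylScalar (B B1 B2 : ℝ → ℝ) (r : ℝ) : ℝ :=
  ((1 - B r) / r ^ 2 + B1 r / r - B2 r / 2) / 3

/-- Weyl sectional curvatures of the coordinate planes, in units of the Weyl scalar. -/
def weylSign (j k : Fin 4) : ℝ :=
  !![0, 1, -1 / 2, -1 / 2; 1, 0, -1 / 2, -1 / 2; -1 / 2, -1 / 2, 0, 1; -1 / 2, -1 / 2, 1, 0] j k

namespace Profile

set_option maxHeartbeats 4000000 in
theorem riemann_eq (h : Profile I B B1 B2 B3 B4) {x : Pt} (hx : x ∈ sphDomain I)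
    (j k l m : Fin 4) : riemann (sphMetric B) x j k l m = sec B B1 B2 j k (x 1) *
      (sphMetric B x j l * sphMetric B x k m - sphMetric B x j m * sphMetric B x k l) := by
  have hB := (h.val_pos _ hx.1).ne'
  have h0 := (h.pos _ hx.1).ne'
  have hS := (sin_pos_of_mem hx).ne'
  -- The only trigonometric relation needed: the angular components mix cos² and sin², and
  -- eliminating cos² leaves rational identities.
  have hC : Real.cos (x 2) ^ 2 = 1 - Real.sin (x 2) ^ 2 := by
    linarith [Real.sin_sq_add_cos_sq (x 2)]
  simp only [riemann, riemannUp, h.pd_christoffel hx, h.christoffel_eq hx, sphMetric_eq,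
    ite_mul, zero_mul, Finset.sum_ite_eq, Finset.mem_univ, if_true, Fin.sum_univ_four]
  fin_cases j <;> fin_cases k <;> fin_cases l <;> fin_cases m <;>
    -- The cancellation lemmas are switched off because they would turn the equations into
    -- disjunctions that `field_simp` and `ring_nf` cannot close.
    simp [radialCoeff, angCoeff, chrRad, chrRad', chrAng, chrAng', sec, -mul_eq_mul_left_iff,
      -mul_eq_mul_right_iff, -mul_eq_zero, -zero_eq_mul] <;>
    field_simp <;> (try simp only [hC]) <;> (try field_simp) <;> ring_nf

/-- In an orthogonal frame that diagonalises the curvature operator, a Ricci eigenvalue is the sum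
of the sectional curvatures of the planes containing that direction. -/
theorem ricci_eq (h : Profile I B B1 B2 B3 B4) {x : Pt} (hx : x ∈ sphDomain I) (k m : Fin 4) :
    ricci (sphMetric B) x k m = ricEig B B1 B2 k (x 1) * sphMetric B x k m := by
  have e : ∀ j, (radialCoeff B j (x 1) * angCoeff j (x 2))⁻¹ *
      (radialCoeff B j (x 1) * angCoeff j (x 2)) = 1 :=
    fun j => inv_mul_cancel₀ (h.coeff_ne_zero hx j)
  have hterm : ∀ j, (radialCoeff B j (x 1) * angCoeff j (x 2))⁻¹ * (sec B B1 B2 j k (x 1) *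
      (radialCoeff B j (x 1) * angCoeff j (x 2) * sphMetric B x k m
        - sphMetric B x j m * sphMetric B x k j))
      = sec B B1 B2 j k (x 1) * (1 - if j = k then 1 else 0) * sphMetric B x k m := by
    intro j
    split_ifs with hjk
    · subst hjk; rw [sphMetric_eq B x j j, if_pos rfl]; ring
    · rw [sphMetric_eq B x k j, if_neg (Ne.symm hjk)]
      linear_combination sec B B1 B2 j k (x 1) * sphMetric B x k m * e j
  simp only [ricci, h.ginv_eq hx, h.riemann_eq hx, ite_mul, zero_mul, Finset.sum_ite_eq,
    Finset.mem_univ, if_true]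
  simp only [sphMetric_eq B x _ _, if_true] at hterm ⊢
  simp only [hterm, ← Finset.sum_mul]
  congr 1
  rw [Fin.sum_univ_four]
  clear hterm
  fin_cases k <;> simp [sec, ricEig, ricT, ricA] <;> ring

theorem scalarCurv_eq (h : Profile I B B1 B2 B3 B4) {x : Pt} (hx : x ∈ sphDomain I) :
    scalarCurv (sphMetric B) x = 2 * ricT B1 B2 (x 1) + 2 * ricA B B1 (x 1) := by
  have hterm : ∀ j, (radialCoeff B j (x 1) * angCoeff j (x 2))⁻¹ * (ricEig B B1 B2 j (x 1) *
      (radialCoeff B j (x 1) * angCoeff j (x 2))) = ricEig B B1 B2 j (x 1) := fun j => by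
    rw [mul_left_comm, inv_mul_cancel₀ (h.coeff_ne_zero hx j), mul_one]
  simp only [scalarCurv, h.ginv_eq hx, h.ricci_eq hx, ite_mul, zero_mul, Finset.sum_ite_eq,
    Finset.mem_univ, if_true, sphMetric_eq, hterm, Fin.sum_univ_four]
  simp [ricEig]; ring

/-- The Weyl curvature of the plane (j, k) is the sectional curvature minus half the sum of the two
Ricci eigenvalues plus R/6. Tracelessness (rows of `weylSign` sum to zero) and spherical symmetry
leave one free scalar. -/
theorem weyl_eq (h : Profile I B B1 B2 B3 B4) {x : Pt} (hx : x ∈ sphDomain I)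
    (j k l m : Fin 4) : weyl (sphMetric B) x j k l m =
      weylScalar B B1 B2 (x 1) * weylSign j k *
      (sphMetric B x j l * sphMetric B x k m - sphMetric B x j m * sphMetric B x k l) := by
  have h0 := (h.pos _ hx.1).ne'
  have key : weyl (sphMetric B) x j k l m = (sec B B1 B2 j k (x 1)
      - (ricEig B B1 B2 j (x 1) + ricEig B B1 B2 k (x 1)) / 2
      + (2 * ricT B1 B2 (x 1) + 2 * ricA B B1 (x 1)) / 6) *
      (sphMetric B x j l * sphMetric B x k m - sphMetric B x j m * sphMetric B x k l) := by
    simp only [weyl, h.riemann_eq hx, h.ricci_eq hx, h.scalarCurv_eq hx]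
    ring
  rw [key]
  by_cases hjk : j = k
  · subst hjk; ring
  · congr 1
    revert hjk
    fin_cases j <;> fin_cases k <;> intro hjk <;>
      first
      | exact absurd rfl hjk
      | (simp [sec, ricEig, ricT, ricA, weylScalar, weylSign]; ring)

theorem hasDerivAt_weylScalar (h : Profile I B B1 B2 B3 B4) {r : ℝ} (hr : r ∈ I) :
    HasDerivAt (weylScalar B B1 B2) ((-2 * (1 - B r) / r ^ 3 - 2 * B1 r / r ^ 2 + B2 r / r
      - B3 r / 2) / 3) r := by
  have h0 := (h.pos _ hr).ne'
  have hr2 : HasDerivAt (fun s : ℝ => s ^ 2) (2 * r) r := by simpa using hasDerivAt_pow 2 r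
  exact HasDerivAt.congr_deriv
    ((((((h.d0 r hr).const_sub 1).fun_div hr2 (pow_ne_zero 2 h0)).fun_add
      ((h.d1 r hr).fun_div (hasDerivAt_id' r) h0)).fun_sub ((h.d2 r hr).div_const 2)).div_const 3)
    (by field_simp; ring)

theorem hasDerivAt_ricT (h : Profile I B B1 B2 B3 B4) {r : ℝ} (hr : r ∈ I) :
    HasDerivAt (ricT B1 B2) (-B3 r / 2 - B2 r / r + B1 r / r ^ 2) r := by
  have h0 := (h.pos _ hr).ne'
  exact HasDerivAt.congr_deriv (((h.d2 r hr).fun_neg.div_const 2).fun_sub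
      ((h.d1 r hr).fun_div (hasDerivAt_id' r) h0)) (by field_simp; ring)

theorem hasDerivAt_ricA (h : Profile I B B1 B2 B3 B4) {r : ℝ} (hr : r ∈ I) :
    HasDerivAt (ricA B B1) (-2 * (1 - B r) / r ^ 3 - B2 r / r) r := by
  have h0 := (h.pos _ hr).ne'
  have hr2 : HasDerivAt (fun s : ℝ => s ^ 2) (2 * r) r := by simpa using hasDerivAt_pow 2 r
  exact HasDerivAt.congr_deriv ((((h.d0 r hr).const_sub 1).fun_div hr2 (pow_ne_zero 2 h0)).fun_sub
      ((h.d1 r hr).fun_div (hasDerivAt_id' r) h0)) (by field_simp; ring)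

end Profile

/-! ### Cotton tensor and derivatives of the Weyl tensor -/

/-- The Cotton scalar, the coefficient of the Cotton tensor. -/
def cottonScalar (B B1 B2 B3 : ℝ → ℝ) (r : ℝ) : ℝ :=
  (r ^ 3 * B3 r + r ^ 2 * B2 r - 2 * r * B1 r + 2 * B r - 2) / (6 * r ^ 3)

/-- Coefficients of the Cotton tensor in units of the Cotton scalar. -/
def cottonSign (j k l : Fin 4) : ℝ :=
  if k = l then (if j = 1 then ![-2, 0, 1, 1] k else 0) else 0

/-- Derivatives of the Ricci eigenvalues. -/
def ricEig' (B B1 B2 B3 : ℝ → ℝ) (k : Fin 4) (r : ℝ) : ℝ :=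
  ![-B3 r / 2 - B2 r / r + B1 r / r ^ 2, -B3 r / 2 - B2 r / r + B1 r / r ^ 2,
    -2 * (1 - B r) / r ^ 3 - B2 r / r, -2 * (1 - B r) / r ^ 3 - B2 r / r] k

namespace Profile

theorem hasDerivAt_ricEig (h : Profile I B B1 B2 B3 B4) {r : ℝ} (hr : r ∈ I) (k : Fin 4) :
    HasDerivAt (ricEig B B1 B2 k) (ricEig' B B1 B2 B3 k r) r := by
  unfold ricEig ricEig'
  fin_cases k
  · exact h.hasDerivAt_ricT hr
  · exact h.hasDerivAt_ricT hr
  · exact h.hasDerivAt_ricA hr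
  · exact h.hasDerivAt_ricA hr

theorem pd_ricci (h : Profile I B B1 B2 B3 B4) {x : Pt} (hx : x ∈ sphDomain I) (i k l : Fin 4) :
    pd i (fun y => ricci (sphMetric B) y k l) x = if k = l then
      ![0, (ricEig' B B1 B2 B3 k (x 1) * radialCoeff B k (x 1)
          + ricEig B B1 B2 k (x 1) * radialCoeff' B B1 k (x 1)) * angCoeff k (x 2),
        ricEig B B1 B2 k (x 1) * radialCoeff B k (x 1) * angCoeff' k (x 2), 0] i else 0 := by
  by_cases hkl : k = l
  · rw [if_pos hkl]
    exact pd_separated h.isOpen hx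
      (fun y hy => by rw [h.ricci_eq hy, sphMetric_eq, if_pos hkl, ← mul_assoc])
      ((h.hasDerivAt_ricEig hx.1 k).fun_mul (h.hasDerivAt_radialCoeff hx.1 k))
      (hasDerivAt_angCoeff k _) i
  · rw [if_neg hkl, pd_separated h.isOpen hx (F := fun _ => 0) (G := fun _ => 0)
      (fun y hy => by rw [h.ricci_eq hy, sphMetric_eq, if_neg hkl, mul_zero, mul_zero])
      (hasDerivAt_const _ _) (hasDerivAt_const _ _)]
    fin_cases i <;> simp

theorem pd_scalarCurv (h : Profile I B B1 B2 B3 B4) {x : Pt} (hx : x ∈ sphDomain I) (i : Fin 4) :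
    pd i (scalarCurv (sphMetric B)) x = ![0, 2 * ricEig' B B1 B2 B3 0 (x 1)
      + 2 * ricEig' B B1 B2 B3 2 (x 1), 0, 0] i := by
  have := pd_separated h.isOpen hx (f := scalarCurv (sphMetric B))
    (F := fun r => 2 * ricT B1 B2 r + 2 * ricA B B1 r)
    (G := fun _ => 1) (fun y hy => by rw [h.scalarCurv_eq hy, mul_one])
    (((h.hasDerivAt_ricT hx.1).const_mul 2).fun_add ((h.hasDerivAt_ricA hx.1).const_mul 2))
    (hasDerivAt_const _ _) i
  rw [this]
  simp [ricEig']

set_option maxHeartbeats 4000000 in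
-- Only radial derivatives survive, so one antisymmetric index must be r. The weights -2, 0, 1, 1
-- sum to zero because the Cotton tensor is traceless.
theorem cotton_eq (h : Profile I B B1 B2 B3 B4) {x : Pt} (hx : x ∈ sphDomain I)
    (j k l : Fin 4) : cotton (sphMetric B) x j k l =
      cottonScalar B B1 B2 B3 (x 1) * radialCoeff B l (x 1) *
        (cottonSign j k l - cottonSign k j l) * angCoeff l (x 2) := by
  have hB := (h.val_pos _ hx.1).ne'
  have h0 := (h.pos _ hx.1).ne'
  have hS := (sin_pos_of_mem hx).ne'
  simp only [cotton, covD2, h.pd_ricci hx, h.pd_scalarCurv hx, h.christoffel_eq hx, h.ricci_eq hx,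
    sphMetric_eq, Fin.sum_univ_four]
  fin_cases j <;> fin_cases k <;> fin_cases l <;>
    simp [radialCoeff, radialCoeff', angCoeff, angCoeff', chrRad, chrAng, ricEig, ricEig', ricT,
      ricA, cottonScalar, cottonSign, -mul_eq_mul_left_iff, -mul_eq_mul_right_iff, -mul_eq_zero,
      -zero_eq_mul] <;>
    field_simp <;> ring_nf

/-- Partial derivatives of the Weyl components. -/
theorem pd_weyl (h : Profile I B B1 B2 B3 B4) {x : Pt} (hx : x ∈ sphDomain I) (i j k l m : Fin 4) :
    pd i (fun y => weyl (sphMetric B) y j k l m) x =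
      weylSign j k * ((if j = l ∧ k = m then 1 else 0) - if j = m ∧ k = l then 1 else 0) *
      ![0, (((-2 * (1 - B (x 1)) / x 1 ^ 3 - 2 * B1 (x 1) / x 1 ^ 2 + B2 (x 1) / x 1
          - B3 (x 1) / 2) / 3) * (radialCoeff B j (x 1) * radialCoeff B k (x 1))
          + weylScalar B B1 B2 (x 1) * (radialCoeff' B B1 j (x 1) * radialCoeff B k (x 1)
            + radialCoeff B j (x 1) * radialCoeff' B B1 k (x 1)))
          * (angCoeff j (x 2) * angCoeff k (x 2)),
        weylScalar B B1 B2 (x 1) * (radialCoeff B j (x 1) * radialCoeff B k (x 1))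
          * (angCoeff' j (x 2) * angCoeff k (x 2) + angCoeff j (x 2) * angCoeff' k (x 2)), 0] i := by
  rw [pd_separated h.isOpen hx
    (F := fun r => weylSign j k * ((if j = l ∧ k = m then 1 else 0)
      - if j = m ∧ k = l then 1 else 0) * (weylScalar B B1 B2 r *
        (radialCoeff B j r * radialCoeff B k r)))
    (G := fun θ => angCoeff j θ * angCoeff k θ) (fun y hy => ?_)
    (((h.hasDerivAt_weylScalar hx.1).fun_mul ((h.hasDerivAt_radialCoeff hx.1 j).fun_mul
      (h.hasDerivAt_radialCoeff hx.1 k))).const_mul _)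
    ((hasDerivAt_angCoeff j _).fun_mul (hasDerivAt_angCoeff k _))]
  · fin_cases i <;> simp <;> ring
  · rw [h.weyl_eq hy]
    simp only [sphMetric_eq, ite_and]
    by_cases h1 : j = l <;> by_cases h2 : k = m <;> by_cases h3 : j = m <;> by_cases h4 : k = l <;>
      simp [h1, h2, h3, h4] <;>
      first | done | (subst_vars; simp_all; done) | (subst_vars; simp_all; ring)

end Profile

/-! ### Divergences of the Weyl and Cotton tensors -/

/-- The derivative of the Cotton scalar. -/
def cottonScalar' (B B1 B2 B3 B4 : ℝ → ℝ) (r : ℝ) : ℝ :=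
  (r * B4 r + 4 * B3 r) / (6 * r) - 3 * cottonScalar B B1 B2 B3 r / r

/-- Eigenvalues of the divergence of the Cotton tensor. -/
def divCottonEig (B B1 B2 B3 B4 : ℝ → ℝ) (k : Fin 4) (r : ℝ) : ℝ :=
  ![-2 * B r * cottonScalar' B B1 B2 B3 B4 r - (4 * B r / r + B1 r) * cottonScalar B B1 B2 B3 r,
    (2 * B r / r - B1 r) * cottonScalar B B1 B2 B3 r,
    B r * cottonScalar' B B1 B2 B3 B4 r + (B r / r + B1 r) * cottonScalar B B1 B2 B3 r,
    B r * cottonScalar' B B1 B2 B3 B4 r + (B r / r + B1 r) * cottonScalar B B1 B2 B3 r] k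

namespace Profile

theorem hasDerivAt_cottonScalar (h : Profile I B B1 B2 B3 B4) {r : ℝ} (hr : r ∈ I) :
    HasDerivAt (cottonScalar B B1 B2 B3) (cottonScalar' B B1 B2 B3 B4 r) r := by
  have h0 := (h.pos _ hr).ne'
  have hp (n : ℕ) : HasDerivAt (fun s : ℝ => s ^ n) (n * r ^ (n - 1)) r := hasDerivAt_pow n r
  have hden : 6 * r ^ 3 ≠ 0 := by positivity
  unfold cottonScalar' cottonScalar
  exact HasDerivAt.congr_deriv
    (((((((hp 3).fun_mul (h.d3 r hr)).fun_add ((hp 2).fun_mul (h.d2 r hr))).fun_sub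
      (((hasDerivAt_id' r).const_mul 2).fun_mul (h.d1 r hr))).fun_add
      ((h.d0 r hr).const_mul 2)).sub_const 2).fun_div ((hp 3).const_mul 6) hden)
    (by field_simp; ring)

theorem pd_cotton (h : Profile I B B1 B2 B3 B4) {x : Pt} (hx : x ∈ sphDomain I)
    (i j k l : Fin 4) : pd i (fun y => cotton (sphMetric B) y j k l) x =
      (cottonSign j k l - cottonSign k j l) *
      ![0, (cottonScalar' B B1 B2 B3 B4 (x 1) * radialCoeff B l (x 1)
          + cottonScalar B B1 B2 B3 (x 1) * radialCoeff' B B1 l (x 1)) * angCoeff l (x 2),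
        cottonScalar B B1 B2 B3 (x 1) * radialCoeff B l (x 1) * angCoeff' l (x 2), 0] i := by
  rw [pd_separated h.isOpen hx (fun y hy => h.cotton_eq hy j k l)
    (((h.hasDerivAt_cottonScalar hx.1).fun_mul (h.hasDerivAt_radialCoeff hx.1 l)).mul_const _)
    (hasDerivAt_angCoeff l _)]
  fin_cases i <;> simp <;> ring

set_option maxHeartbeats 4000000 in
/-- The divergence of the Weyl tensor is `-1/2` times the Cotton tensor. -/
theorem divWeyl_eq (h : Profile I B B1 B2 B3 B4) {x : Pt} (hx : x ∈ sphDomain I)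
    (j k l : Fin 4) : divWeyl (sphMetric B) x j k l = -(1 / 2) * cotton (sphMetric B) x j k l := by
  have hB := (h.val_pos _ hx.1).ne'
  have h0 := (h.pos _ hx.1).ne'
  have hS := (sin_pos_of_mem hx).ne'
  simp only [divWeyl, covD4, h.cotton_eq hx, h.pd_weyl hx, h.christoffel_eq hx, h.weyl_eq hx,
    h.ginv_eq hx, sphMetric_eq, ite_mul, zero_mul, Finset.sum_ite_eq, Finset.mem_univ, if_true,
    Fin.sum_univ_four]
  fin_cases j <;> fin_cases k <;> fin_cases l <;>
    simp [radialCoeff, radialCoeff', angCoeff, angCoeff', chrRad, chrAng, weylSign, weylScalar,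
      cottonScalar, cottonSign, -mul_eq_mul_left_iff, -mul_eq_mul_right_iff, -mul_eq_zero,
      -zero_eq_mul] <;>
    field_simp <;> ring_nf

set_option maxHeartbeats 4000000 in
theorem divCotton_eq (h : Profile I B B1 B2 B3 B4) {x : Pt} (hx : x ∈ sphDomain I)
    (k l : Fin 4) : divCotton (sphMetric B) x k l =
      divCottonEig B B1 B2 B3 B4 k (x 1) * sphMetric B x k l := by
  have hB := (h.val_pos _ hx.1).ne'
  have h0 := (h.pos _ hx.1).ne'
  have hS := (sin_pos_of_mem hx).ne'
  simp only [divCotton, covD3, h.cotton_eq hx, h.pd_cotton hx, h.christoffel_eq hx,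
    h.ginv_eq hx, sphMetric_eq, ite_mul, zero_mul, Finset.sum_ite_eq, Finset.mem_univ, if_true,
    Fin.sum_univ_four]
  fin_cases k <;> fin_cases l <;>
    simp [radialCoeff, radialCoeff', angCoeff, angCoeff', chrRad, chrAng, divCottonEig, cottonSign,
      -mul_eq_mul_left_iff, -mul_eq_mul_right_iff, -mul_eq_zero, -zero_eq_mul] <;>
    field_simp <;> ring_nf

end Profile

/-! ### Bach tensor -/

/-- Eigenvalues of the Bach tensor. -/
def bachEig (B B1 B2 B3 B4 : ℝ → ℝ) (k : Fin 4) (r : ℝ) : ℝ :=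
  -divCottonEig B B1 B2 B3 B4 k r + weylScalar B B1 B2 r * (ricA B B1 r - ricT B1 B2 r) *
    ![1, 1, -1, -1] k

namespace Profile

/-- The proportionality of the Weyl divergence to Cotton is known only on the chart domain, so the
partial derivatives are recomputed from the separated form; the connection terms are linear and
follow pointwise. -/
theorem div_divWeyl_eq (h : Profile I B B1 B2 B3 B4) {x : Pt} (hx : x ∈ sphDomain I)
    (k l : Fin 4) : ∑ i, ∑ j, ginv (sphMetric B) x i j *
      covD3 (sphMetric B) (divWeyl (sphMetric B)) x i j k l
      = -(1 / 2) * divCotton (sphMetric B) x k l := by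
  have hpd : ∀ i j, pd i (fun y => divWeyl (sphMetric B) y j k l) x
      = -(1 / 2) * pd i (fun y => cotton (sphMetric B) y j k l) x := by
    intro i j
    rw [h.pd_cotton hx, pd_separated h.isOpen hx (F := fun r => -(1 / 2) *
        (cottonScalar B B1 B2 B3 r * radialCoeff B l r * (cottonSign j k l - cottonSign k j l)))
      (fun y hy => by rw [h.divWeyl_eq hy, h.cotton_eq hy]; ring)
      ((((h.hasDerivAt_cottonScalar hx.1).fun_mul
        (h.hasDerivAt_radialCoeff hx.1 l)).mul_const _).const_mul _)
      (hasDerivAt_angCoeff l _)]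
    fin_cases i <;> simp <;> ring
  simp only [divCotton, covD3, hpd, h.divWeyl_eq hx, Finset.mul_sum]
  refine Finset.sum_congr rfl fun i _ => Finset.sum_congr rfl fun j _ => ?_
  simp only [Fin.sum_univ_four]
  ring

set_option maxHeartbeats 1000000 in
-- Since Weyl is traceless, only the difference of the two Ricci eigenvalues can contribute.
theorem ricci_weyl_eq (h : Profile I B B1 B2 B3 B4) {x : Pt} (hx : x ∈ sphDomain I)
    (k l : Fin 4) : ∑ j, ∑ m, (∑ a, ∑ b, ginv (sphMetric B) x j a * ginv (sphMetric B) x m b *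
        ricci (sphMetric B) x a b) * weyl (sphMetric B) x j k l m
      = weylScalar B B1 B2 (x 1) * (ricA B B1 (x 1) - ricT B1 B2 (x 1)) * ![1, 1, -1, -1] k *
        sphMetric B x k l := by
  have hB := (h.val_pos _ hx.1).ne'
  have h0 := (h.pos _ hx.1).ne'
  have hS := (sin_pos_of_mem hx).ne'
  simp only [h.ricci_eq hx, h.weyl_eq hx, h.ginv_eq hx, sphMetric_eq, ite_mul, zero_mul,
    mul_ite, mul_zero, Finset.sum_ite_eq, Finset.mem_univ, if_true, Fin.sum_univ_four]
  fin_cases k <;> fin_cases l <;>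
    simp [radialCoeff, angCoeff, ricEig, weylSign, -mul_eq_mul_left_iff,
      -mul_eq_mul_right_iff, -mul_eq_zero, -zero_eq_mul] <;>
    field_simp <;> ring_nf

theorem bach_eq (h : Profile I B B1 B2 B3 B4) {x : Pt} (hx : x ∈ sphDomain I)
    (k l : Fin 4) : bach (sphMetric B) x k l =
      bachEig B B1 B2 B3 B4 k (x 1) * sphMetric B x k l := by
  rw [bach, h.div_divWeyl_eq hx, h.ricci_weyl_eq hx, h.divCotton_eq hx, bachEig]
  ring

end Profile

/-! ### From the smoothness hypothesis to profiles; calculus on I -/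

theorem profile_of_contDiffOn (hI : IsOpen I) (hpos : ∀ r ∈ I, 0 < r) (hB : ContDiffOn ℝ 4 B I)
    (hBpos : ∀ r ∈ I, 0 < B r) : Profile I B (deriv B) (deriv (deriv B)) (deriv (deriv (deriv B)))
      (deriv (deriv (deriv (deriv B)))) := by
  have h1 : ContDiffOn ℝ 3 (deriv B) I := hB.deriv_of_isOpen hI (by norm_num)
  have h2 : ContDiffOn ℝ 2 (deriv (deriv B)) I := h1.deriv_of_isOpen hI (by norm_num)
  have h3 : ContDiffOn ℝ 1 (deriv (deriv (deriv B))) I := h2.deriv_of_isOpen hI (by norm_num)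
  have key : ∀ {f : ℝ → ℝ} {n : WithTop ℕ∞}, ContDiffOn ℝ n f I → n ≠ 0 →
      ∀ r ∈ I, HasDerivAt f (deriv f r) r := fun hf hn r hr =>
    ((hf.differentiableOn hn).differentiableAt (hI.mem_nhds hr)).hasDerivAt
  exact ⟨hI, hpos, hBpos, key hB (by norm_num), key h1 (by norm_num), key h2 (by norm_num),
    key h3 (by norm_num)⟩

/-- A point of the chart with prescribed radius, on the equator. -/
theorem exists_mem_sphDomain {r : ℝ} (hr : r ∈ I) :
    ∃ x ∈ sphDomain I, x 1 = r := by
  refine ⟨![0, r, Real.pi / 2, 0], ⟨by simpa using hr, ?_⟩, by simp⟩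
  have := Real.pi_pos
  simp only [Matrix.cons_val]
  constructor <;> linarith

theorem eq_const_of_hasDerivAt_zero (hI : IsOpen I) (hc : IsConnected I) {f f' : ℝ → ℝ}
    (hf : ∀ r ∈ I, HasDerivAt f (f' r) r) (h0 : ∀ r ∈ I, f' r = 0) : ∃ c, ∀ r ∈ I, f r = c :=
  hI.exists_is_const_of_deriv_eq_zero hc.isPreconnected
    (fun r hr => (hf r hr).differentiableAt.differentiableWithinAt)
    (fun r hr => by rw [(hf r hr).deriv]; exact h0 r hr)

/-- Functions that agree on an open set have the same derivative there. -/
theorem hasDerivAt_unique_of_eqOn (hI : IsOpen I) {f g : ℝ → ℝ} {f' g' r : ℝ} (hr : r ∈ I)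
    (hfg : ∀ s ∈ I, f s = g s) (hf : HasDerivAt f f' r) (hg : HasDerivAt g g' r) : f' = g' := by
  have : f =ᶠ[nhds r] g := Filter.eventuallyEq_of_mem (hI.mem_nhds hr) hfg
  exact hf.unique (hg.congr_of_eventuallyEq this)

/-! ### Geometric conditions as equations in r -/

namespace Profile

theorem metric_diag_ne_zero (h : Profile I B B1 B2 B3 B4) {x : Pt} (hx : x ∈ sphDomain I)
    (j : Fin 4) : sphMetric B x j j ≠ 0 := by
  rw [sphMetric_eq, if_pos rfl]; exact h.coeff_ne_zero hx j

theorem scalarFlatOn_iff (h : Profile I B B1 B2 B3 B4) : ScalarFlatOn (sphMetric B) (sphDomain I) ↔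
    ∀ r ∈ I, 2 * ((1 - B r) / r ^ 2) - 4 * (B1 r / r) - B2 r = 0 := by
  have e : ∀ r, 2 * ricT B1 B2 r + 2 * ricA B B1 r
      = 2 * ((1 - B r) / r ^ 2) - 4 * (B1 r / r) - B2 r := fun r => by simp only [ricT, ricA]; ring
  constructor
  · intro H r hr
    obtain ⟨x, hx, rfl⟩ := exists_mem_sphDomain hr
    rw [← e, ← h.scalarCurv_eq hx]; exact H x hx
  · intro H x hx
    rw [h.scalarCurv_eq hx, e]; exact H _ hx.1

theorem conformallyFlatOn_iff (h : Profile I B B1 B2 B3 B4) :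
    ConformallyFlatOn (sphMetric B) (sphDomain I) ↔ ∀ r ∈ I, weylScalar B B1 B2 r = 0 := by
  constructor
  · intro H r hr
    obtain ⟨x, hx, rfl⟩ := exists_mem_sphDomain hr
    have h1 := H x hx 0 1 0 1
    rw [h.weyl_eq hx, sphMetric_eq B x 0 1, sphMetric_eq B x 1 0] at h1
    simpa [weylSign, h.metric_diag_ne_zero hx] using h1
  · intro H x hx j k l m
    rw [h.weyl_eq hx, H _ hx.1]; ring

theorem harmonicOn_iff (h : Profile I B B1 B2 B3 B4) :
    HarmonicOn (sphMetric B) (sphDomain I) ↔ ∀ r ∈ I, cottonScalar B B1 B2 B3 r = 0 := by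
  constructor
  · intro H r hr
    obtain ⟨x, hx, rfl⟩ := exists_mem_sphDomain hr
    -- In the (r, θ, θ) component the antisymmetrised pattern equals 1, so q is read off up to a
    -- nonzero factor.
    have h1 := H x hx 1 2 2
    rw [h.divWeyl_eq hx, h.cotton_eq hx] at h1
    simpa [cottonSign, radialCoeff, angCoeff, (h.pos _ hx.1).ne'] using h1
  · intro H x hx j k l
    rw [h.divWeyl_eq hx, h.cotton_eq hx, H _ hx.1]; ring

theorem biharmonicOn_iff (h : Profile I B B1 B2 B3 B4) :
    BiharmonicOn (sphMetric B) (sphDomain I) ↔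
      ∀ r ∈ I, ∀ k, divCottonEig B B1 B2 B3 B4 k r = 0 := by
  constructor
  · intro H r hr k
    obtain ⟨x, hx, rfl⟩ := exists_mem_sphDomain hr
    have h1 := H x hx k k
    rw [h.divCotton_eq hx] at h1
    exact (mul_eq_zero.1 h1).resolve_right (h.metric_diag_ne_zero hx k)
  · intro H x hx k l
    rw [h.divCotton_eq hx, H _ hx.1, zero_mul]

theorem bachFlatOn_iff (h : Profile I B B1 B2 B3 B4) :
    BachFlatOn (sphMetric B) (sphDomain I) ↔ ∀ r ∈ I, ∀ k, bachEig B B1 B2 B3 B4 k r = 0 := by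
  constructor
  · intro H r hr k
    obtain ⟨x, hx, rfl⟩ := exists_mem_sphDomain hr
    have h1 := H x hx k k
    rw [h.bach_eq hx] at h1
    exact (mul_eq_zero.1 h1).resolve_right (h.metric_diag_ne_zero hx k)
  · intro H x hx k l
    rw [h.bach_eq hx, H _ hx.1, zero_mul]

theorem einsteinOn_iff (h : Profile I B B1 B2 B3 B4) : EinsteinOn (sphMetric B) (sphDomain I) ↔
    ∃ c, ∀ r ∈ I, ∀ k, ricEig B B1 B2 k r = c := by
  constructor
  · rintro ⟨c, H⟩
    refine ⟨c, fun r hr k => ?_⟩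
    obtain ⟨x, hx, rfl⟩ := exists_mem_sphDomain hr
    have h1 := H x hx k k
    rw [h.ricci_eq hx] at h1
    exact mul_right_cancel₀ (h.metric_diag_ne_zero hx k) h1
  · rintro ⟨c, H⟩
    exact ⟨c, fun x hx k l => by rw [h.ricci_eq hx, H _ hx.1]⟩

theorem sec_eq_of_constantCurvature (h : Profile I B B1 B2 B3 B4) {x : Pt}
    (hx : x ∈ sphDomain I) {K : ℝ} (H : ∀ j k l m, riemann (sphMetric B) x j k l m =
      K * (sphMetric B x j l * sphMetric B x k m - sphMetric B x j m * sphMetric B x k l))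
    {j k : Fin 4} (hjk : j ≠ k) : sec B B1 B2 j k (x 1) = K := by
  have h1 := H j k j k
  rw [h.riemann_eq hx, sphMetric_eq B x j k, if_neg hjk, zero_mul, sub_zero] at h1
  exact mul_right_cancel₀
    (mul_ne_zero (h.metric_diag_ne_zero hx j) (h.metric_diag_ne_zero hx k)) h1

/-! ### Laurent profiles and integration of the differential equations -/

/-- Derivatives of a profile given by a Laurent polynomial. -/
theorem derivs_of_laurent (h : Profile I B B1 B2 B3 B4) {p m b0 b1 b2 : ℝ}
    (hB : ∀ r ∈ I, B r = p / r ^ 2 + m / r + b0 + b1 * r + b2 * r ^ 2) {r : ℝ} (hr : r ∈ I) :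
    B1 r = -2 * p / r ^ 3 - m / r ^ 2 + b1 + 2 * b2 * r ∧
      B2 r = 6 * p / r ^ 4 + 2 * m / r ^ 3 + 2 * b2 ∧
      B3 r = -24 * p / r ^ 5 - 6 * m / r ^ 4 ∧ B4 r = 120 * p / r ^ 6 + 24 * m / r ^ 5 := by
  have hq : ∀ (c : ℝ) (n : ℕ), ∀ s ∈ I,
      HasDerivAt (fun s => c / s ^ n) (-(n * c) / s ^ (n + 1)) s := by
    intro c n s hs
    have h0 := (h.pos s hs).ne'
    refine ((hasDerivAt_const s c).fun_div (hasDerivAt_pow n s) (pow_ne_zero n h0)).congr_deriv ?_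
    rcases n with _ | n
    · simp
    · simp only [Nat.add_sub_cancel]; field_simp; push_cast; ring
  have e1 : ∀ s ∈ I, B1 s = -2 * p / s ^ 3 - m / s ^ 2 + b1 + 2 * b2 * s := by
    intro s hs
    have h0 := (h.pos s hs).ne'
    refine hasDerivAt_unique_of_eqOn h.isOpen hs hB (h.d0 s hs) ?_
    have hm := hq m 1 s hs
    simp only [pow_one] at hm
    exact (((((hq p 2 s hs).fun_add hm).add_const b0).fun_add
      ((hasDerivAt_id' s).const_mul b1)).fun_add ((hasDerivAt_pow 2 s).const_mul b2)).congr_deriv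
      (by simp; ring)
  have e2 : ∀ s ∈ I, B2 s = 6 * p / s ^ 4 + 2 * m / s ^ 3 + 2 * b2 := by
    intro s hs
    refine hasDerivAt_unique_of_eqOn h.isOpen hs e1 (h.d1 s hs) ?_
    exact ((((hq (-2 * p) 3 s hs).fun_sub (hq m 2 s hs)).add_const b1).fun_add
      ((hasDerivAt_id' s).const_mul (2 * b2))).congr_deriv (by push_cast; ring)
  have e3 : ∀ s ∈ I, B3 s = -24 * p / s ^ 5 - 6 * m / s ^ 4 := by
    intro s hs
    refine hasDerivAt_unique_of_eqOn h.isOpen hs e2 (h.d2 s hs) ?_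
    exact (((hq (6 * p) 4 s hs).fun_add (hq (2 * m) 3 s hs)).add_const (2 * b2)).congr_deriv
      (by push_cast; ring)
  refine ⟨e1 r hr, e2 r hr, e3 r hr, ?_⟩
  refine hasDerivAt_unique_of_eqOn h.isOpen hr e3 (h.d3 r hr) ?_
  exact ((hq (-24 * p) 5 r hr).fun_sub (hq (6 * m) 4 r hr)).congr_deriv (by push_cast; ring)

/-- The equation says (r²(B - 1))'' = 0. The two first integrals are (r²(B - 1))' and the affine
remainder. -/
theorem exists_form_of_scalarFlat (h : Profile I B B1 B2 B3 B4) (hc : IsConnected I)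
    (H : ∀ r ∈ I, 2 * ((1 - B r) / r ^ 2) - 4 * (B1 r / r) - B2 r = 0) :
    ∃ bm2 bm1 : ℝ, ∀ r ∈ I, B r = bm2 / r ^ 2 + bm1 / r + 1 := by
  obtain ⟨c, hcst⟩ := eq_const_of_hasDerivAt_zero h.isOpen hc
    (f := fun s => 2 * s * B s + s ^ 2 * B1 s - 2 * s)
    (fun r hr => ((((hasDerivAt_id' r).const_mul 2).fun_mul (h.d0 r hr)).fun_add
      ((hasDerivAt_pow 2 r).fun_mul (h.d1 r hr))).fun_sub ((hasDerivAt_id' r).const_mul 2))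
    (fun r hr => by
      have h0 := (h.pos r hr).ne'
      have := H r hr
      field_simp at this
      simp; linear_combination -this)
  obtain ⟨d, hd⟩ := eq_const_of_hasDerivAt_zero h.isOpen hc
    (f := fun s => s ^ 2 * B s - s ^ 2 - c * s)
    (fun r hr => (((hasDerivAt_pow 2 r).fun_mul (h.d0 r hr)).fun_sub
      (hasDerivAt_pow 2 r)).fun_sub ((hasDerivAt_id' r).const_mul c))
    (fun r hr => by have := hcst r hr; simp; linear_combination this)
  refine ⟨d, c, fun r hr => ?_⟩
  have h0 := (h.pos r hr).ne'
  have := hd r hr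
  field_simp
  linear_combination this

/-- Because w = -(r/6)((B - 1)/r)'', the equation prescribes a second derivative. The source -m/r³
serves the harmonic case, and m = 0 the conformally flat one. -/
theorem exists_form_of_weylScalar (h : Profile I B B1 B2 B3 B4) (hc : IsConnected I) {m : ℝ}
    (H : ∀ r ∈ I, weylScalar B B1 B2 r = -m / r ^ 3) :
    ∃ b1 b2 : ℝ, ∀ r ∈ I, B r = m / r + 1 + b1 * r + b2 * r ^ 2 := by
  obtain ⟨c, hcst⟩ := eq_const_of_hasDerivAt_zero h.isOpen hc
    (f := fun s => (s * B1 s - B s + 1) / s ^ 2 + 2 * m / s ^ 3)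
    (fun r hr => ((((((hasDerivAt_id' r).fun_mul (h.d1 r hr)).fun_sub (h.d0 r hr)).add_const
      1).fun_div (hasDerivAt_pow 2 r) (pow_ne_zero 2 (h.pos r hr).ne')).fun_add
      ((hasDerivAt_const r (2 * m)).fun_div (hasDerivAt_pow 3 r)
        (pow_ne_zero 3 (h.pos r hr).ne'))))
    (fun r hr => by
      have h0 := (h.pos r hr).ne'
      have := H r hr
      simp only [weylScalar] at this
      field_simp at this
      field_simp
      push_cast
      norm_num
      linear_combination -r ^ 2 * this)
  obtain ⟨d, hd⟩ := eq_const_of_hasDerivAt_zero h.isOpen hc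
    (f := fun s => (B s - 1) / s - m / s ^ 2 - c * s)
    (fun r hr => ((((h.d0 r hr).sub_const 1).fun_div (hasDerivAt_id' r) (h.pos r hr).ne').fun_sub
      ((hasDerivAt_const r m).fun_div (hasDerivAt_pow 2 r)
        (pow_ne_zero 2 (h.pos r hr).ne'))).fun_sub ((hasDerivAt_id' r).const_mul c))
    (fun r hr => by
      have h0 := (h.pos r hr).ne'
      have := hcst r hr
      field_simp at this
      field_simp
      norm_num
      linear_combination r * this)
  refine ⟨d, c, fun r hr => ?_⟩
  have h0 := (h.pos r hr).ne'
  have := hd r hr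
  field_simp at this ⊢
  linear_combination this

theorem exists_form_of_cottonScalar (h : Profile I B B1 B2 B3 B4) (hc : IsConnected I)
    (H : ∀ r ∈ I, cottonScalar B B1 B2 B3 r = 0) :
    ∃ bm1 b1 b2 : ℝ, ∀ r ∈ I, B r = bm1 / r + 1 + b1 * r + b2 * r ^ 2 := by
  -- The identity (r³w)' = -r³q makes r³w a first integral.
  obtain ⟨c, hcst⟩ := eq_const_of_hasDerivAt_zero h.isOpen hc
    (f := fun s => s ^ 3 * weylScalar B B1 B2 s)
    (fun r hr => (hasDerivAt_pow 3 r).fun_mul (h.hasDerivAt_weylScalar hr))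
    (fun r hr => by
      have h0 := (h.pos r hr).ne'
      have := H r hr
      simp only [cottonScalar] at this
      simp only [weylScalar]
      field_simp at this
      field_simp
      norm_num
      linear_combination -r ^ 2 * this)
  refine ⟨-c, h.exists_form_of_weylScalar hc fun r hr => ?_⟩
  have h0 := (h.pos r hr).ne'
  rw [← hcst r hr]
  field_simp

/-- A = 0 makes (r(B - 1))'/r² constant, so r(B - 1) is a multiple of r³ plus a constant. -/
theorem exists_form_of_ricEig (h : Profile I B B1 B2 B3 B4) (hc : IsConnected I)
    (H : ∀ r ∈ I, (1 - B r) / r ^ 2 + B2 r / 2 = 0) :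
    ∃ bm1 b2 : ℝ, ∀ r ∈ I, B r = bm1 / r + 1 + b2 * r ^ 2 := by
  obtain ⟨c, hcst⟩ := eq_const_of_hasDerivAt_zero h.isOpen hc
    (f := fun s => (B s - 1 + s * B1 s) / s ^ 2)
    (fun r hr => ((((h.d0 r hr).sub_const 1).fun_add
      ((hasDerivAt_id' r).fun_mul (h.d1 r hr))).fun_div (hasDerivAt_pow 2 r)
        (pow_ne_zero 2 (h.pos r hr).ne')))
    (fun r hr => by
      have h0 := (h.pos r hr).ne'
      have := H r hr
      field_simp at this
      field_simp
      norm_num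
      linear_combination r * this)
  obtain ⟨d, hd⟩ := eq_const_of_hasDerivAt_zero h.isOpen hc
    (f := fun s => s * (B s - 1) - c / 3 * s ^ 3)
    (fun r hr => ((hasDerivAt_id' r).fun_mul ((h.d0 r hr).sub_const 1)).fun_sub
      ((hasDerivAt_pow 3 r).const_mul (c / 3)))
    (fun r hr => by
      have h0 := (h.pos r hr).ne'
      have := hcst r hr
      field_simp at this
      norm_num
      linear_combination this)
  refine ⟨d, c / 3, fun r hr => ?_⟩
  have h0 := (h.pos r hr).ne'
  have := hd r hr
  field_simp at this ⊢
  linear_combination this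

/-- The left side is (rB)''''; the four constants come from successive integrations of (rB)''',
(rB)'', (rB)' and rB. -/
theorem exists_cubic_form (h : Profile I B B1 B2 B3 B4) (hc : IsConnected I)
    (H : ∀ r ∈ I, r * B4 r + 4 * B3 r = 0) :
    ∃ bm1 b0 b1 b2 : ℝ, ∀ r ∈ I, B r = bm1 / r + b0 + b1 * r + b2 * r ^ 2 := by
  obtain ⟨c, hcst⟩ := eq_const_of_hasDerivAt_zero h.isOpen hc
    (f := fun s => s * B3 s + 3 * B2 s)
    (fun r hr => ((hasDerivAt_id' r).fun_mul (h.d3 r hr)).fun_add ((h.d2 r hr).const_mul 3))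
    (fun r hr => by linear_combination H r hr)
  obtain ⟨d, hd⟩ := eq_const_of_hasDerivAt_zero h.isOpen hc
    (f := fun s => s * B2 s + 2 * B1 s - c * s)
    (fun r hr => (((hasDerivAt_id' r).fun_mul (h.d2 r hr)).fun_add
      ((h.d1 r hr).const_mul 2)).fun_sub ((hasDerivAt_id' r).const_mul c))
    (fun r hr => by linear_combination hcst r hr)
  obtain ⟨e, he⟩ := eq_const_of_hasDerivAt_zero h.isOpen hc
    (f := fun s => s * B1 s + B s - c / 2 * s ^ 2 - d * s)
    (fun r hr => ((((hasDerivAt_id' r).fun_mul (h.d1 r hr)).fun_add (h.d0 r hr)).fun_sub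
      ((hasDerivAt_pow 2 r).const_mul (c / 2))).fun_sub ((hasDerivAt_id' r).const_mul d))
    (fun r hr => by norm_num; linear_combination hd r hr)
  obtain ⟨m, hm⟩ := eq_const_of_hasDerivAt_zero h.isOpen hc
    (f := fun s => s * B s - c / 6 * s ^ 3 - d / 2 * s ^ 2 - e * s)
    (fun r hr => ((((hasDerivAt_id' r).fun_mul (h.d0 r hr)).fun_sub
      ((hasDerivAt_pow 3 r).const_mul (c / 6))).fun_sub
      ((hasDerivAt_pow 2 r).const_mul (d / 2))).fun_sub ((hasDerivAt_id' r).const_mul e))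
    (fun r hr => by norm_num; linear_combination he r hr)
  refine ⟨m, e, d / 2, c / 6, fun r hr => ?_⟩
  have h0 := (h.pos r hr).ne'
  have := hm r hr
  field_simp at this ⊢
  linear_combination this

/-- Derivatives of a profile whose product with the radius is cubic. -/
theorem derivs_of_cubic (h : Profile I B B1 B2 B3 B4) {m b0 b1 b2 : ℝ}
    (hB : ∀ r ∈ I, B r = m / r + b0 + b1 * r + b2 * r ^ 2) {r : ℝ} (hr : r ∈ I) :
    B1 r = -m / r ^ 2 + b1 + 2 * b2 * r ∧ B2 r = 2 * m / r ^ 3 + 2 * b2 ∧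
      B3 r = -6 * m / r ^ 4 ∧ B4 r = 24 * m / r ^ 5 := by
  obtain ⟨e1, e2, e3, e4⟩ := h.derivs_of_laurent (p := 0) (m := m) (b0 := b0) (b1 := b1) (b2 := b2)
    (fun s hs => by rw [hB s hs]; ring) hr
  exact ⟨by rw [e1]; ring, by rw [e2]; ring, by rw [e3]; ring, by rw [e4]; ring⟩

/-! ### Solution families of each equation -/

theorem scalarFlat_ode_iff (h : Profile I B B1 B2 B3 B4) (hc : IsConnected I) :
    (∀ r ∈ I, 2 * ((1 - B r) / r ^ 2) - 4 * (B1 r / r) - B2 r = 0) ↔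
      ∃ bm2 bm1 : ℝ, ∀ r ∈ I, B r = bm2 / r ^ 2 + bm1 / r + 1 := by
  refine ⟨h.exists_form_of_scalarFlat hc, ?_⟩
  rintro ⟨p, m, hB⟩ r hr
  have h0 := (h.pos r hr).ne'
  obtain ⟨e1, e2, -, -⟩ := h.derivs_of_laurent (p := p) (m := m) (b0 := 1) (b1 := 0) (b2 := 0)
    (fun s hs => by rw [hB s hs]; ring) hr
  rw [e1, e2, hB r hr]
  field_simp
  ring

theorem weylScalar_of_cubic (h : Profile I B B1 B2 B3 B4) {m b0 b1 b2 : ℝ}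
    (hB : ∀ r ∈ I, B r = m / r + b0 + b1 * r + b2 * r ^ 2) {r : ℝ} (hr : r ∈ I) :
    weylScalar B B1 B2 r = (1 - b0) / (3 * r ^ 2) - m / r ^ 3 := by
  have h0 := (h.pos r hr).ne'
  obtain ⟨e1, e2, -, -⟩ := h.derivs_of_cubic hB hr
  rw [weylScalar, e1, e2, hB r hr]
  field_simp
  ring

/-- Here r³w = (1 - b₀)r/3 - m, so its derivative -r³q sees only the deviation of b₀ from 1. -/
theorem cottonScalar_of_cubic (h : Profile I B B1 B2 B3 B4) {m b0 b1 b2 : ℝ}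
    (hB : ∀ r ∈ I, B r = m / r + b0 + b1 * r + b2 * r ^ 2) {r : ℝ} (hr : r ∈ I) :
    cottonScalar B B1 B2 B3 r = (b0 - 1) / (3 * r ^ 3) := by
  have h0 := (h.pos r hr).ne'
  obtain ⟨e1, e2, e3, -⟩ := h.derivs_of_cubic hB hr
  rw [cottonScalar, e1, e2, e3, hB r hr]
  field_simp
  ring

theorem weylScalar_ode_iff (h : Profile I B B1 B2 B3 B4) (hc : IsConnected I) :
    (∀ r ∈ I, weylScalar B B1 B2 r = 0) ↔
      ∃ b1 b2 : ℝ, ∀ r ∈ I, B r = 1 + b1 * r + b2 * r ^ 2 := by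
  constructor
  · intro H
    obtain ⟨b1, b2, hB⟩ := h.exists_form_of_weylScalar hc (m := 0) (by simpa using H)
    exact ⟨b1, b2, fun r hr => by rw [hB r hr]; ring⟩
  · rintro ⟨b1, b2, hB⟩ r hr
    rw [h.weylScalar_of_cubic (m := 0) (b0 := 1) (b1 := b1) (b2 := b2)
      (fun s hs => by rw [hB s hs]; ring) hr]
    simp

theorem cottonScalar_ode_iff (h : Profile I B B1 B2 B3 B4) (hc : IsConnected I) :
    (∀ r ∈ I, cottonScalar B B1 B2 B3 r = 0) ↔
      ∃ bm1 b1 b2 : ℝ, ∀ r ∈ I, B r = bm1 / r + 1 + b1 * r + b2 * r ^ 2 := by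
  refine ⟨h.exists_form_of_cottonScalar hc, ?_⟩
  rintro ⟨m, b1, b2, hB⟩ r hr
  rw [h.cottonScalar_of_cubic hB hr]
  simp

theorem divCotton_ode_iff (h : Profile I B B1 B2 B3 B4) (hc : IsConnected I) :
    (∀ r ∈ I, ∀ k, divCottonEig B B1 B2 B3 B4 k r = 0) ↔
      (∃ bm1 b1 b2 : ℝ, ∀ r ∈ I, B r = bm1 / r + 1 + b1 * r + b2 * r ^ 2) ∨
        ∃ κ : ℝ, ∀ r ∈ I, B r = κ * r ^ 2 := by
  constructor
  · intro H
    obtain ⟨m, b0, b1, b2, hB⟩ := h.exists_cubic_form hc fun r hr => by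
      have h0 := (h.pos r hr).ne'
      have hB := (h.val_pos r hr).ne'
      have ht := H r hr 0
      have hrr := H r hr 1
      simp only [divCottonEig, Matrix.cons_val] at ht hrr
      -- In the difference of the t and r eigenvalues the terms in q and B' cancel, leaving a
      -- multiple of this product.
      have : B r * (r * B4 r + 4 * B3 r) = 0 := by
        simp only [cottonScalar'] at ht
        field_simp at ht hrr
        linear_combination 3 * hrr - ht / 2
      exact (mul_eq_zero.1 this).resolve_left hB
    by_cases hb : b0 = 1
    · exact Or.inl ⟨m, b1, b2, fun r hr => by rw [hB r hr, hb]⟩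
    · refine Or.inr ⟨b2, ?_⟩
      have hb' : b0 - 1 ≠ 0 := sub_ne_zero.2 hb
      -- For b₀ ≠ 1 the Cotton scalar vanishes nowhere, so the r eigenvalue forces 2B/r - B' = 0. A
      -- polynomial vanishing on an open set has zero coefficients, extracted below by
      -- differentiating twice.
      have key : ∀ r ∈ I, 3 * m + 2 * b0 * r + b1 * r ^ 2 = 0 := by
        intro r hr
        have h0 := (h.pos r hr).ne'
        have hrr := H r hr 1
        obtain ⟨e1, -, -, -⟩ := h.derivs_of_cubic hB hr
        simp only [divCottonEig, Matrix.cons_val] at hrr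
        rw [h.cottonScalar_of_cubic hB hr, e1, hB r hr] at hrr
        have := (mul_eq_zero.1 hrr).resolve_right (div_ne_zero hb' (by positivity))
        field_simp at this
        linear_combination this
      have key1 : ∀ r ∈ I, 2 * b0 + 2 * b1 * r = 0 := fun r hr =>
        hasDerivAt_unique_of_eqOn h.isOpen hr key
          (((((hasDerivAt_id' r).const_mul (2 * b0)).const_add (3 * m)).fun_add
            ((hasDerivAt_pow 2 r).const_mul b1)).congr_deriv (by norm_num; ring))
          (hasDerivAt_const r (0 : ℝ))
      have key2 : ∀ r ∈ I, 2 * b1 = 0 := fun r hr =>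
        hasDerivAt_unique_of_eqOn h.isOpen hr key1
          ((((hasDerivAt_id' r).const_mul (2 * b1)).const_add (2 * b0)).congr_deriv (by ring))
          (hasDerivAt_const r (0 : ℝ))
      intro r hr
      have hb1 : b1 = 0 := by linarith [key2 r hr]
      have hb0 : b0 = 0 := by have := key1 r hr; rw [hb1] at this; linarith
      have hm : m = 0 := by have := key r hr; rw [hb1, hb0] at this; linarith
      rw [hB r hr, hb1, hb0, hm]; ring
  · intro H
    -- Both families are put in the cubic form so that one set of derivative formulas serves them.
    obtain ⟨m, b0, b1, b2, hB, hz⟩ : ∃ m b0 b1 b2 : ℝ,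
        (∀ r ∈ I, B r = m / r + b0 + b1 * r + b2 * r ^ 2) ∧
          (b0 = 1 ∨ (m = 0 ∧ b0 = 0 ∧ b1 = 0)) := by
      rcases H with ⟨m, b1, b2, hB⟩ | ⟨κ, hB⟩
      · exact ⟨m, 1, b1, b2, hB, Or.inl rfl⟩
      · exact ⟨0, 0, 0, κ, fun r hr => by rw [hB r hr]; ring, Or.inr ⟨rfl, rfl, rfl⟩⟩
    intro r hr k
    have h0 := (h.pos r hr).ne'
    obtain ⟨e1, e2, e3, e4⟩ := h.derivs_of_cubic hB hr
    simp only [divCottonEig, cottonScalar', h.cottonScalar_of_cubic hB hr, e1, e3, e4, hB r hr]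
    rcases hz with rfl | ⟨rfl, rfl, rfl⟩
    · fin_cases k <;> simp <;> field_simp <;> norm_num
    · fin_cases k <;> simp <;> field_simp <;> norm_num

theorem bachEig_of_cubic (h : Profile I B B1 B2 B3 B4) {m b0 b1 b2 : ℝ}
    (hB : ∀ r ∈ I, B r = m / r + b0 + b1 * r + b2 * r ^ 2) {r : ℝ} (hr : r ∈ I) (k : Fin 4) :
    bachEig B B1 B2 B3 B4 k r = (1 - b0 ^ 2 + 3 * b1 * m) / (3 * r ^ 4) * ![1, 1, -1, -1] k := by
  have h0 := (h.pos r hr).ne'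
  obtain ⟨e1, e2, e3, e4⟩ := h.derivs_of_cubic hB hr
  simp only [bachEig, divCottonEig, cottonScalar', h.cottonScalar_of_cubic hB hr,
    h.weylScalar_of_cubic hB hr, ricA, ricT, e1, e2, e3, e4, hB r hr]
  fin_cases k <;> simp <;> field_simp <;> ring

theorem bach_ode_iff (h : Profile I B B1 B2 B3 B4) (hc : IsConnected I) :
    (∀ r ∈ I, ∀ k, bachEig B B1 B2 B3 B4 k r = 0) ↔
      ∃ bm1 b0 b1 b2 : ℝ, 1 - b0 ^ 2 = -3 * b1 * bm1 ∧
        ∀ r ∈ I, B r = bm1 / r + b0 + b1 * r + b2 * r ^ 2 := by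
  constructor
  · intro H
    obtain ⟨m, b0, b1, b2, hB⟩ := h.exists_cubic_form hc fun r hr => by
      have h0 := (h.pos r hr).ne'
      have hB := (h.val_pos r hr).ne'
      have ht := H r hr 0
      have hrr := H r hr 1
      simp only [bachEig, divCottonEig, Matrix.cons_val] at ht hrr
      -- The Ricci–Weyl term is the same for t and r and drops out of the difference. The identity
      -- `e` is stated for arbitrary q to keep the Cotton scalar opaque while denominators are
      -- cleared.
      have hd : B r * (r * B4 r + 4 * B3 r) / (3 * r) = 0 := by
        have e : ∀ q : ℝ, 2 * B r * ((r * B4 r + 4 * B3 r) / (6 * r) - 3 * q / r)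
            = B r * (r * B4 r + 4 * B3 r) / (3 * r) - 6 * B r * q / r := fun q => by
          field_simp; ring
        simp only [cottonScalar'] at ht
        linear_combination ht - hrr - e (cottonScalar B B1 B2 B3 r)
      have := (div_eq_zero_iff.1 hd).resolve_right (by positivity)
      exact (mul_eq_zero.1 this).resolve_left hB
    refine ⟨m, b0, b1, b2, ?_, hB⟩
    -- The remaining constraint involves only constants, so a single radius suffices.
    obtain ⟨r, hr⟩ := hc.nonempty
    have h0 := (h.pos r hr).ne'
    have := H r hr 1
    rw [h.bachEig_of_cubic hB hr] at this
    simp only [Matrix.cons_val, mul_one] at this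
    have := (div_eq_zero_iff.1 this).resolve_right (by positivity)
    linear_combination this
  · rintro ⟨m, b0, b1, b2, hz, hB⟩ r hr k
    rw [h.bachEig_of_cubic hB hr, show 1 - b0 ^ 2 + 3 * b1 * m = 0 by linear_combination hz]
    simp

end Profile

/-! ### The Bach-flat families -/

/-- The Bach-flat profiles are the Mannheim–Kazanas family and one further family. -/
theorem mannheimKazanas_iff (hpos : ∀ r ∈ I, 0 < r) :
    (∃ bm1 b0 b1 b2 : ℝ, 1 - b0 ^ 2 = -3 * b1 * bm1 ∧
        ∀ r ∈ I, B r = bm1 / r + b0 + b1 * r + b2 * r ^ 2) ↔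
      (∃ β b1 b2 : ℝ, ∀ r ∈ I,
          B r = -(β * (2 - 3 * b1 * β)) / r + (1 - 3 * b1 * β) + b1 * r + b2 * r ^ 2) ∨
        ∃ bm1 b2 : ℝ, ∀ r ∈ I, B r = bm1 / r - 1 + b2 * r ^ 2 := by
  constructor
  · rintro ⟨m, b0, b1, b2, hz, hB⟩
    -- If b₁ = 0 then b₀ = ±1, and the Mannheim–Kazanas form reaches only b₀ = 1. Otherwise b₀ = 1 -
    -- 3b₁β determines β, and the constraint then determines the 1/r coefficient.
    by_cases hb1 : b1 = 0
    · subst hb1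
      have : (b0 - 1) * (b0 + 1) = 0 := by linear_combination -hz
      rcases mul_eq_zero.1 this with h | h
      · exact Or.inl ⟨-m / 2, 0, b2, fun r hr => by
          rw [hB r hr, sub_eq_zero.1 h]; ring⟩
      · exact Or.inr ⟨m, b2, fun r hr => by
          rw [hB r hr, eq_neg_of_add_eq_zero_left h]; ring⟩
    · refine Or.inl ⟨(1 - b0) / (3 * b1), b1, b2, fun r hr => ?_⟩
      have h0 := (hpos r hr).ne'
      rw [hB r hr, show m = -((1 - b0 ^ 2) / (3 * b1)) by field_simp; linear_combination hz]
      field_simp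
      ring
  · rintro (⟨β, b1, b2, hB⟩ | ⟨m, b2, hB⟩)
    · exact ⟨_, _, b1, b2, by ring, hB⟩
    · exact ⟨m, -1, 0, b2, by norm_num, fun r hr => by rw [hB r hr]; ring⟩

/-! ### Scalar-flat Ricci tensor, Einstein and constant-curvature metrics -/

namespace Profile

/-- R = 0 makes the two Ricci eigenvalues opposite, -A/2 on (t, r) and A/2 on the sphere; the terms
in u and n reverse the sign of (A/2)g exactly on the first block. -/
theorem ricci_of_scalarFlat_form
    (h : Profile I B (deriv B) (deriv (deriv B)) B3 B4) {p m : ℝ}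
    (hB : ∀ r ∈ I, B r = p / r ^ 2 + m / r + 1) :
    (∀ r ∈ I, funA B r = 2 * p / r ^ 4) ∧ ∀ x ∈ sphDomain I, ∀ j k,
      ricci (sphMetric B) x j k = 2 * p / x 1 ^ 4 * (velocity B x j * velocity B x k
        + (1 / 2) * sphMetric B x j k - radial B x j * radial B x k) := by
  have hd := fun {r : ℝ} (hr : r ∈ I) =>
    h.derivs_of_laurent (p := p) (m := m) (b0 := 1) (b1 := 0) (b2 := 0)
      (fun s hs => by rw [hB s hs]; ring) hr
  constructor
  · intro r hr
    have h0 := (h.pos r hr).ne'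
    obtain ⟨-, e2, -, -⟩ := hd hr
    rw [funA, e2, hB r hr]
    field_simp
    ring
  · intro x hx j k
    have h0 := (h.pos _ hx.1).ne'
    have hpos := h.val_pos _ hx.1
    have hs : Real.sqrt (B (x 1)) ^ 2 = B (x 1) := Real.sq_sqrt hpos.le
    have hs' : Real.sqrt (B (x 1)) ≠ 0 := (Real.sqrt_pos.2 hpos).ne'
    obtain ⟨e1, e2, -, -⟩ := hd hx.1
    have hT : ricT (deriv B) (deriv (deriv B)) (x 1) = -(p / x 1 ^ 4) := by
      rw [ricT, e1, e2]; field_simp; ring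
    have hA : ricA B (deriv B) (x 1) = p / x 1 ^ 4 := by
      rw [ricA, e1, hB _ hx.1]; field_simp; ring
    rw [h.ricci_eq hx]
    by_cases hjk : j = k
    · subst hjk
      have hu : velocity B x j * velocity B x j = ![B (x 1), 0, 0, 0] j := by
        fin_cases j <;> simp [velocity, hpos.le]
      have hn : radial B x j * radial B x j = ![0, 1 / B (x 1), 0, 0] j := by
        fin_cases j <;> simp [radial, ← mul_inv, hpos.le]
      rw [hu, hn, sphMetric_eq, if_pos rfl]
      fin_cases j <;> simp [ricEig, hT, hA, radialCoeff, angCoeff] <;> ring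
    · have hu : velocity B x j * velocity B x k = 0 := by
        revert hjk
        fin_cases j <;> fin_cases k <;> simp [velocity]
      have hn : radial B x j * radial B x k = 0 := by
        revert hjk
        fin_cases j <;> fin_cases k <;> simp [radial]
      rw [hu, hn, sphMetric_eq, if_neg hjk]
      ring

theorem funA_ode_iff (h : Profile I B (deriv B) (deriv (deriv B)) B3 B4) (hc : IsConnected I) :
    (∀ r ∈ I, funA B r = 0) ↔
      ∃ bm1 b2 : ℝ, ∀ r ∈ I, B r = bm1 / r + 1 + b2 * r ^ 2 := by
  refine ⟨h.exists_form_of_ricEig hc, ?_⟩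
  rintro ⟨m, b2, hB⟩ r hr
  have h0 := (h.pos r hr).ne'
  obtain ⟨-, e2, -, -⟩ := h.derivs_of_cubic (m := m) (b0 := 1) (b1 := 0) (b2 := b2)
    (fun s hs => by rw [hB s hs]; ring) hr
  rw [funA, e2, hB r hr]
  field_simp
  ring

theorem einsteinOn_iff_form (h : Profile I B (deriv B) (deriv (deriv B)) B3 B4)
    (hc : IsConnected I) : EinsteinOn (sphMetric B) (sphDomain I) ↔
      ∃ bm1 b2 : ℝ, ∀ r ∈ I, B r = bm1 / r + 1 + b2 * r ^ 2 := by
  rw [h.einsteinOn_iff]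
  constructor
  · rintro ⟨c, H⟩
    refine h.exists_form_of_ricEig hc fun r hr => ?_
    have e0 := H r hr 0
    have e2 := H r hr 2
    simp only [ricEig, ricT, ricA, Matrix.cons_val] at e0 e2
    linear_combination e2 - e0
  · rintro ⟨m, b2, hB⟩
    -- Equality of the eigenvalues fixes the family, on which their common value is already
    -- constant.
    refine ⟨-3 * b2, fun r hr k => ?_⟩
    have h0 := (h.pos r hr).ne'
    obtain ⟨e1, e2, -, -⟩ := h.derivs_of_cubic (m := m) (b0 := 1) (b1 := 0) (b2 := b2)
      (fun s hs => by rw [hB s hs]; ring) hr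
    simp only [ricEig, ricT, ricA, e1, e2, hB r hr]
    fin_cases k <;> simp <;> field_simp <;> ring

theorem riemann_of_flat_form (h : Profile I B B1 B2 B3 B4) {b2 : ℝ}
    (hB : ∀ r ∈ I, B r = 1 + b2 * r ^ 2) {x : Pt} (hx : x ∈ sphDomain I) :
    scalarCurv (sphMetric B) x = -12 * b2 ∧ ∀ j k l m, riemann (sphMetric B) x j k l m =
      scalarCurv (sphMetric B) x / 12 *
        (sphMetric B x j l * sphMetric B x k m - sphMetric B x j m * sphMetric B x k l) := by
  have h0 := (h.pos _ hx.1).ne'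
  obtain ⟨e1, e2, -, -⟩ := h.derivs_of_cubic (m := 0) (b0 := 1) (b1 := 0) (b2 := b2)
    (fun s hs => by rw [hB s hs]; ring) hx.1
  have hR : scalarCurv (sphMetric B) x = -12 * b2 := by
    rw [h.scalarCurv_eq hx, ricT, ricA, e1, e2, hB _ hx.1]
    field_simp
    ring
  refine ⟨hR, fun j k l m => ?_⟩
  rw [h.riemann_eq hx, hR]
  by_cases hjk : j = k
  · subst hjk; ring
  · congr 1
    revert hjk
    simp only [sec, e1, e2, hB _ hx.1]
    fin_cases j <;> fin_cases k <;> intro hjk <;>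
      first
      | exact absurd rfl hjk
      | (simp; field_simp)

theorem constantCurvatureOn_iff (h : Profile I B B1 B2 B3 B4) :
    ConstantCurvatureOn (sphMetric B) (sphDomain I) ↔
      ∃ b2 : ℝ, ∀ r ∈ I, B r = 1 + b2 * r ^ 2 := by
  constructor
  · rintro ⟨K, H⟩
    refine ⟨-K, fun r hr => ?_⟩
    have h0 := (h.pos r hr).ne'
    obtain ⟨x, hx, rfl⟩ := exists_mem_sphDomain hr
    -- The (θ, φ) plane has curvature (1 - B)/r², free of derivatives, so B is read off with no
    -- integration.
    have hs : sec B B1 B2 2 3 (x 1) = K := h.sec_eq_of_constantCurvature hx (H x hx) (by decide)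
    simp only [sec, Matrix.of_apply, Matrix.cons_val] at hs
    field_simp at hs
    linear_combination -hs
  · rintro ⟨b2, hB⟩
    refine ⟨-b2, fun x hx j k l m => ?_⟩
    obtain ⟨hR, hRm⟩ := h.riemann_of_flat_form hB hx
    rw [hRm, hR]; ring

/-- On the Einstein family w = -m/r³, so conformal flatness only removes the mass term. -/
theorem flat_form_iff (h : Profile I B B1 B2 B3 B4) :
    (∃ b2 : ℝ, ∀ r ∈ I, B r = 1 + b2 * r ^ 2) ↔
      (∃ bm1 b2 : ℝ, ∀ r ∈ I, B r = bm1 / r + 1 + b2 * r ^ 2) ∧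
        ∀ r ∈ I, weylScalar B B1 B2 r = 0 := by
  constructor
  · rintro ⟨b2, hB⟩
    refine ⟨⟨0, b2, fun r hr => by rw [hB r hr]; ring⟩, fun r hr => ?_⟩
    rw [h.weylScalar_of_cubic (m := 0) (b0 := 1) (b1 := 0) (b2 := b2)
      (fun s hs => by rw [hB s hs]; ring) hr]
    simp
  · rintro ⟨⟨m, b2, hB⟩, H⟩
    refine ⟨b2, fun r hr => ?_⟩
    have := H r hr
    rw [h.weylScalar_of_cubic (m := m) (b0 := 1) (b1 := 0) (b2 := b2)
      (fun s hs => by rw [hB s hs]; ring) hr] at this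
    have hm : m = 0 := by simpa [(h.pos r hr).ne'] using this
    rw [hB r hr, hm]; ring

end Profile

end StaticSpherical

end

/-! ### Assembly -/

theorem mainTheorem7 (B : ℝ → ℝ) (I : Set ℝ) (hIopen : IsOpen I) (hIconn : IsConnected I)
    (hIpos : ∀ r ∈ I, 0 < r) (hB : ContDiffOn ℝ 4 B I) (hBpos : ∀ r ∈ I, 0 < B r) :
    -- a) zero scalar curvature
    ((StaticSpherical.ScalarFlatOn (StaticSpherical.sphMetric B) (StaticSpherical.sphDomain I) ↔
        ∀ r ∈ I, 2 * ((1 - B r) / r ^ 2) - 4 * (deriv B r / r) - deriv (deriv B) r = 0) ∧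
      (StaticSpherical.ScalarFlatOn (StaticSpherical.sphMetric B) (StaticSpherical.sphDomain I) ↔
        ∃ bm2 bm1 : ℝ, ∀ r ∈ I, B r = bm2 / r ^ 2 + bm1 / r + 1) ∧
      (∀ bm2 bm1 : ℝ, (∀ r ∈ I, B r = bm2 / r ^ 2 + bm1 / r + 1) →
        (∀ r ∈ I, StaticSpherical.funA B r = 2 * bm2 / r ^ 4) ∧
        ∀ x ∈ StaticSpherical.sphDomain I, ∀ j k,
          StaticSpherical.ricci (StaticSpherical.sphMetric B) x j k =
            2 * bm2 / x 1 ^ 4 *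
              (StaticSpherical.velocity B x j * StaticSpherical.velocity B x k
                + (1 / 2) * StaticSpherical.sphMetric B x j k
                - StaticSpherical.radial B x j * StaticSpherical.radial B x k))) ∧
    -- b) conformally flat
    ((StaticSpherical.ConformallyFlatOn (StaticSpherical.sphMetric B)
          (StaticSpherical.sphDomain I) ↔ ∀ r ∈ I, StaticSpherical.funE B r = 0) ∧
      (StaticSpherical.ConformallyFlatOn (StaticSpherical.sphMetric B)
          (StaticSpherical.sphDomain I) ↔
        ∃ b1 b2 : ℝ, ∀ r ∈ I, B r = 1 + b1 * r + b2 * r ^ 2)) ∧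
    -- c) harmonic
    (StaticSpherical.HarmonicOn (StaticSpherical.sphMetric B) (StaticSpherical.sphDomain I) ↔
        ∃ bm1 b1 b2 : ℝ, ∀ r ∈ I, B r = bm1 / r + 1 + b1 * r + b2 * r ^ 2) ∧
    -- d) bi-harmonic
    ((StaticSpherical.BiharmonicOn (StaticSpherical.sphMetric B) (StaticSpherical.sphDomain I) ↔
        (∃ bm1 b1 b2 : ℝ, ∀ r ∈ I, B r = bm1 / r + 1 + b1 * r + b2 * r ^ 2) ∨
        ∃ κ : ℝ, ∀ r ∈ I, B r = κ * r ^ 2) ∧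
      (∀ κ : ℝ, (∀ r ∈ I, B r = κ * r ^ 2) →
        ¬ StaticSpherical.HarmonicOn (StaticSpherical.sphMetric B)
            (StaticSpherical.sphDomain I) ∧
        ∀ r ∈ I, StaticSpherical.funA B r = 1 / r ^ 2 ∧
          StaticSpherical.funE B r = 1 / (2 * r ^ 2))) ∧
    -- e) Einstein
    ((StaticSpherical.EinsteinOn (StaticSpherical.sphMetric B) (StaticSpherical.sphDomain I) ↔
        ∀ r ∈ I, StaticSpherical.funA B r = 0) ∧
      (StaticSpherical.EinsteinOn (StaticSpherical.sphMetric B) (StaticSpherical.sphDomain I) ↔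
        ∃ bm1 b2 : ℝ, ∀ r ∈ I, B r = bm1 / r + 1 + b2 * r ^ 2)) ∧
    -- f) constant curvature
    ((StaticSpherical.ConstantCurvatureOn (StaticSpherical.sphMetric B)
          (StaticSpherical.sphDomain I) ↔
        (∀ r ∈ I, StaticSpherical.funA B r = 0) ∧
        StaticSpherical.ConformallyFlatOn (StaticSpherical.sphMetric B)
          (StaticSpherical.sphDomain I)) ∧
      (StaticSpherical.ConstantCurvatureOn (StaticSpherical.sphMetric B)
          (StaticSpherical.sphDomain I) ↔
        ∃ b2 : ℝ, ∀ r ∈ I, B r = 1 + b2 * r ^ 2) ∧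
      (∀ b2 : ℝ, (∀ r ∈ I, B r = 1 + b2 * r ^ 2) →
        ∀ x ∈ StaticSpherical.sphDomain I,
          StaticSpherical.scalarCurv (StaticSpherical.sphMetric B) x = -12 * b2 ∧
          ∀ j k l m, StaticSpherical.riemann (StaticSpherical.sphMetric B) x j k l m =
            StaticSpherical.scalarCurv (StaticSpherical.sphMetric B) x / 12 *
              (StaticSpherical.sphMetric B x j l * StaticSpherical.sphMetric B x k m
                - StaticSpherical.sphMetric B x j m * StaticSpherical.sphMetric B x k l))) ∧
    -- g) zero Bach tensor
    ((StaticSpherical.BachFlatOn (StaticSpherical.sphMetric B) (StaticSpherical.sphDomain I) ↔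
        ∃ bm1 b0 b1 b2 : ℝ, 1 - b0 ^ 2 = -3 * b1 * bm1 ∧
          ∀ r ∈ I, B r = bm1 / r + b0 + b1 * r + b2 * r ^ 2) ∧
      (StaticSpherical.BachFlatOn (StaticSpherical.sphMetric B) (StaticSpherical.sphDomain I) ↔
        (∃ β b1 b2 : ℝ, ∀ r ∈ I,
          B r = -(β * (2 - 3 * b1 * β)) / r + (1 - 3 * b1 * β) + b1 * r + b2 * r ^ 2) ∨
        ∃ bm1 b2 : ℝ, ∀ r ∈ I, B r = bm1 / r - 1 + b2 * r ^ 2)) := by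
  have h := StaticSpherical.profile_of_contDiffOn hIopen hIpos hB hBpos
  have hE : (∀ r ∈ I, StaticSpherical.funE B r = 0) ↔
      ∀ r ∈ I, StaticSpherical.weylScalar B (deriv B) (deriv (deriv B)) r = 0 :=
    forall₂_congr fun r _ => by
      rw [show StaticSpherical.funE B r
        = 3 / 2 * StaticSpherical.weylScalar B (deriv B) (deriv (deriv B)) r by
          simp only [StaticSpherical.funE, StaticSpherical.weylScalar]; ring]
      simp
  have hA := h.funA_ode_iff hIconn
  have hCC := h.constantCurvatureOn_iff
  refine ⟨⟨h.scalarFlatOn_iff, h.scalarFlatOn_iff.trans (h.scalarFlat_ode_iff hIconn), ?_⟩,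
    ⟨h.conformallyFlatOn_iff.trans hE.symm,
      h.conformallyFlatOn_iff.trans (h.weylScalar_ode_iff hIconn)⟩,
    h.harmonicOn_iff.trans (h.cottonScalar_ode_iff hIconn),
    ⟨h.biharmonicOn_iff.trans (h.divCotton_ode_iff hIconn), ?_⟩,
    ⟨(h.einsteinOn_iff_form hIconn).trans hA.symm, h.einsteinOn_iff_form hIconn⟩,
    ⟨hCC.trans ?_, hCC, ?_⟩,
    h.bachFlatOn_iff.trans (h.bach_ode_iff hIconn),
    (h.bachFlatOn_iff.trans (h.bach_ode_iff hIconn)).trans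
      (StaticSpherical.mannheimKazanas_iff hIpos)⟩
  · exact fun p m hform => h.ricci_of_scalarFlat_form hform
  · intro κ hform
    have hform' : ∀ r ∈ I, B r = 0 / r + 0 + 0 * r + κ * r ^ 2 := fun r hr => by
      rw [hform r hr]; ring
    constructor
    -- With b₀ = 0 the Cotton scalar is -1/(3r³), which never vanishes.
    · rw [h.harmonicOn_iff]
      intro H
      obtain ⟨r, hr⟩ := hIconn.nonempty
      have := H r hr
      rw [h.cottonScalar_of_cubic hform' hr] at this
      simp [(hIpos r hr).ne'] at this
    · intro r hr
      have h0 := (hIpos r hr).ne'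
      obtain ⟨e1, e2, -, -⟩ := h.derivs_of_cubic hform' hr
      rw [StaticSpherical.funA, StaticSpherical.funE, e1, e2, hform r hr]
      constructor <;> field_simp <;> ring
  · rw [hA, h.conformallyFlatOn_iff]
    exact h.flat_form_iff
  · exact fun b2 hform x hx => h.riemann_of_flat_form hform hx
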